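/- Let $P\subset\mathbb R^3$ be a simple 3-polytope, i.e. a 3-dimensional convex polytope (the convex hull of finitely many points, with nonempty interior) each of whose vertices lies in exactly three facets. A simple edge-cycle of $P$ is a simple closed curve in $\partial P$ that is a union of edges of $P$. The following two conditions are equivalent. (1) The facets of $P$ can be colored in at most $4$ colors so that any two different adjacent facets (that is, facets with nonempty intersection; in a simple 3-polytope such facets share an edge) have different colors. (2) There is a set $S$ of pairwise disjoint simple edge-cycles of $P$ such that - every vertex of $P$ lies on exactly one cycle of $S$; - for every cycle $\gamma\in S$ and every connected component $C$ of $\partial P\setminus\gamma$ (there are two of them), the number of vertices $v$ on $\gamma$ such that the edge of $P$ incident to $v$ and not lying on $\gamma$ goes inside $C$ (that is, its relative interior lies in $C$) is even. -/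

import Mathlib

/-- Euclidean three-space. -/
abbrev E3 : Type := EuclideanSpace ℝ (Fin 3)

/-- `F` is a `k`-dimensional face of `P`: a nonempty set on which some linear functional attains its
maximum over `P`, whose affine hull has dimension `k`. -/
def IsFaceOfDim (P : Set E3) (k : ℕ) (F : Set E3) : Prop :=
  F.Nonempty ∧ IsExposed ℝ P F ∧ Module.finrank ℝ (vectorSpan ℝ F) = k

/-- A simple 3-polytope: the convex hull of finitely many points, with nonempty interior (that is,
3-dimensional), such that every vertex lies in exactly three facets. -/
structure IsSimpleThreePolytope (P : Set E3) : Prop where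
  exists_finset : ∃ s : Finset E3, P = convexHull ℝ (s : Set E3)
  interior_nonempty : (interior P).Nonempty
  simple : ∀ v : E3, IsFaceOfDim P 0 {v} → {F : Set E3 | IsFaceOfDim P 2 F ∧ v ∈ F}.ncard = 3

/-- The vertices of `P`, as a type. -/
abbrev PVertex (P : Set E3) : Type := {v : E3 // IsFaceOfDim P 0 {v}}

/-- The facets of a 3-polytope `P`, as a type. -/
abbrev PFacet (P : Set E3) : Type := {F : Set E3 // IsFaceOfDim P 2 F}

/-- Adjacency of facets: different facets are adjacent when they meet (for a simple 3-polytope this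
means that they share an edge). -/
def facetGraph (P : Set E3) : SimpleGraph (PFacet P) where
  Adj F G := F ≠ G ∧ ((F : Set E3) ∩ (G : Set E3)).Nonempty
  symm := ⟨fun _ _ h => ⟨h.1.symm, by rw [Set.inter_comm]; exact h.2⟩⟩
  loopless := ⟨fun _ h => h.1 rfl⟩

/-- The graph of vertices and edges of `P`. -/
def edgeGraph (P : Set E3) : SimpleGraph (PVertex P) where
  Adj v w := v ≠ w ∧ IsFaceOfDim P 1 (segment ℝ (v : E3) (w : E3))
  symm := ⟨fun _ _ h => ⟨h.1.symm, by rw [segment_symm]; exact h.2⟩⟩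
  loopless := ⟨fun _ h => h.1 rfl⟩

/-- A simple edge-cycle of `P`, without base point or orientation: a subgraph of the edge graph that
is traced out by a closed walk with no repeated edges and vertices. -/
def IsSimpleEdgeCycle {P : Set E3} (γ : (edgeGraph P).Subgraph) : Prop :=
  ∃ (v : PVertex P) (p : (edgeGraph P).Walk v v), p.IsCycle ∧ p.toSubgraph = γ

/-- The closed curve in the boundary of `P` formed by the edges of `γ`. -/
def curve {P : Set E3} (γ : (edgeGraph P).Subgraph) : Set E3 :=
  {x | ∃ v w : PVertex P, γ.Adj v w ∧ x ∈ segment ℝ (v : E3) (w : E3)}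

/-- `C` is a connected component of the complement of the curve of `γ` in the boundary of `P`. -/
def IsSide {P : Set E3} (γ : (edgeGraph P).Subgraph) (C : Set E3) : Prop :=
  ∃ x ∈ frontier P \ curve γ, C = connectedComponentIn (frontier P \ curve γ) x

/-- The vertices of `γ` from which an edge of `P` not on `γ` goes inside `C`. -/
def inwardVertices {P : Set E3} (γ : (edgeGraph P).Subgraph) (C : Set E3) : Set (PVertex P) :=
  {v | v ∈ γ.verts ∧ ∃ w : PVertex P, (edgeGraph P).Adj v w ∧ ¬ γ.Adj v w ∧
    openSegment ℝ (v : E3) (w : E3) ⊆ C}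

/-!
Both conditions are compared with three-colourings of the edges of `P` in which the three edges at
every vertex have different colours.

Given a colouring of the facets by `(ℤ/2)²`, colour an edge by the sum of the colours of its two
facets; at each vertex the three nonzero elements occur. The edges of two of these colours form a
spanning subgraph of degree two, whose components are the required cycles
(`exists_even_cycles`). For a side `C` of such a cycle, the vertices in `C` are matched among
themselves by the edges of one of the two colours, and together with the inward vertices they are
matched by the edges of the third colour; so the number of inward vertices is even.

Conversely, every edge leaving a cycle `γ` of the family enters exactly one side, so `γ` has even
length (`even_ncard_verts`). Colour its edges alternately by two nonzero elements of `(ℤ/2)²`, and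
the edges off the cycles by the third. At every vertex the colours sum to zero, and such an edge
colouring is induced by a colouring of the facets (`exists_inducesAt`), which is then proper. This
last step is the vanishing of the first cohomology of the sphere; it is proved by sweeping the
vertices with a generic linear functional, since a functional on a facet has a unique local minimum.
In neither direction is the Jordan curve theorem needed: it does not matter how many sides a cycle
has.

The geometry enters through `VertexChart`. The cone of inward normals at a vertex `v` has a compact
base, whose extreme points expose different facets (`vectorSpan_levelFace_of_extreme`); there are
three facets, so by the Krein–Milman theorem this cone is spanned by three linearly independent
vectors. Hence near `v` the polytope is a simplicial cone, whose rays are the three edges at `v`.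
-/

open scoped RealInnerProductSpace

/-! ### Normal cones and exposed faces -/

/-- The inward normal cone of `P` at `v`: the vectors `a` such that `⟪a, ·⟫` attains its minimum
over `P` at `v` (if `v ∈ P`). -/
def inwardNormals (P : Set E3) (v : E3) : Set E3 :=
  {a | ∀ x ∈ P, 0 ≤ ⟪a, x - v⟫}

/-- The subset of `P` on which `⟪a, ·⟫` takes the same value as at `v`. -/
def levelFace (P : Set E3) (v a : E3) : Set E3 :=
  {x ∈ P | ⟪a, x - v⟫ = 0}

/-- If `l` is an inward normal of a polytope at `v` and `m` is nonnegative on the face exposed by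
`l`, then `m + K • l` is an inward normal for large `K`. It suffices to check this on the finitely
many generators of the polytope. -/
lemma exists_nonneg_add_smul {s : Finset E3} {v l m : E3}
    (hl : l ∈ inwardNormals (convexHull ℝ (s : Set E3)) v)
    (hm : ∀ x ∈ convexHull ℝ (s : Set E3), ⟪l, x - v⟫ = 0 → 0 ≤ ⟪m, x - v⟫) :
    ∃ K : ℝ, 0 < K ∧ m + K • l ∈ inwardNormals (convexHull ℝ (s : Set E3)) v := by
  have key : ∀ y ∈ s, ∀ᶠ K : ℝ in Filter.atTop, 0 ≤ ⟪m + K • l, y - v⟫ := by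
    intro y hy
    have hyP : y ∈ convexHull ℝ (s : Set E3) := subset_convexHull ℝ _ hy
    rcases (hl y hyP).eq_or_lt with h | h
    · refine Filter.Eventually.of_forall fun K => ?_
      rw [inner_add_left, real_inner_smul_left, ← h, mul_zero, add_zero]
      exact hm y hyP h.symm
    · filter_upwards [Filter.eventually_ge_atTop (-⟪m, y - v⟫ / ⟪l, y - v⟫)] with K hK
      rw [div_le_iff₀ h] at hK
      rw [inner_add_left, real_inner_smul_left]
      linarith
  obtain ⟨K, hK, hK0⟩ := (((Filter.eventually_all_finset s).2 key).and
    (Filter.eventually_gt_atTop 0)).exists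
  refine ⟨K, hK0, fun x hx => ?_⟩
  have hconv : Convex ℝ {x : E3 | 0 ≤ ⟪m + K • l, x - v⟫} := by
    have : {x : E3 | 0 ≤ ⟪m + K • l, x - v⟫}
        = {x : E3 | ⟪m + K • l, v⟫ ≤ innerSL ℝ (m + K • l) x} := by
      ext x; simp only [Set.mem_ofPred_eq, innerSL_apply_apply, inner_sub_right, sub_nonneg]
    rw [this]
    exact convex_halfSpace_ge (innerSL ℝ (m + K • l)).isLinear _
  exact convexHull_min (fun y hy => hK y hy) hconv hx

lemma isExposed_levelFace {P : Set E3} {v a : E3} (hv : v ∈ P) (ha : a ∈ inwardNormals P v) :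
    IsExposed ℝ P (levelFace P v a) := by
  intro _
  refine ⟨innerSL ℝ (-a), ?_⟩
  ext x
  simp only [levelFace, Set.mem_ofPred_eq, innerSL_apply_apply, inner_neg_left, neg_le_neg_iff]
  refine and_congr_right fun hx => ⟨fun h y hy => ?_, fun h => ?_⟩
  · have := ha y hy
    rw [inner_sub_right] at this h
    linarith
  · have h1 := ha x hx
    have h2 := h v hv
    rw [inner_sub_right] at h1 ⊢
    linarith

lemma exists_levelFace_eq {P F : Set E3} (hF : IsExposed ℝ P F) {v : E3} (hv : v ∈ F) :
    ∃ a ∈ inwardNormals P v, F = levelFace P v a := by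
  obtain ⟨l, hl⟩ := hF ⟨v, hv⟩
  have hvP : v ∈ P := hF.subset hv
  have hlv : ∀ y ∈ P, l y ≤ l v := by rw [hl] at hv; exact hv.2
  obtain ⟨b, rfl⟩ := (InnerProductSpace.toDual ℝ E3).surjective l
  simp only [InnerProductSpace.toDual_apply_apply] at hl hlv
  refine ⟨-b, fun x hx => ?_, ?_⟩
  · have := hlv x hx
    rw [inner_neg_left, inner_sub_right]; linarith
  · rw [hl]
    ext x
    simp only [levelFace, Set.mem_ofPred_eq, inner_neg_left, inner_sub_right]
    refine and_congr_right fun hx => ⟨fun h => ?_, fun h y hy => ?_⟩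
    · have := h v hvP; have := hlv x hx; linarith
    · have := hlv y hy; linarith

lemma mem_extremePoints_of_isFaceOfDim_zero {P : Set E3} {v : E3} (h : IsFaceOfDim P 0 {v}) :
    v ∈ P.extremePoints ℝ :=
  isExtreme_singleton.1 h.2.1.isExtreme

/-- Extreme points of a polytope are exposed, by separation from the other generators. -/
lemma isFaceOfDim_zero_of_mem_extremePoints {s : Finset E3} {v : E3}
    (h : v ∈ (convexHull ℝ (s : Set E3)).extremePoints ℝ) :
    IsFaceOfDim (convexHull ℝ (s : Set E3)) 0 {v} := by
  classical
  refine ⟨Set.singleton_nonempty v, ?_, by simp⟩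
  set P := convexHull ℝ (s : Set E3) with hP
  have hvP : v ∈ P := extremePoints_subset h
  have hnot : v ∉ convexHull ℝ ((s.erase v : Finset E3) : Set E3) := by
    intro hmem
    have := ((convex_convexHull ℝ (s : Set E3)).mem_extremePoints_iff_mem_sdiff_convexHull_sdiff.1
      h).2
    refine this (convexHull_mono ?_ hmem)
    intro y hy
    rw [Finset.coe_erase] at hy
    exact ⟨subset_convexHull ℝ _ hy.1, hy.2⟩
  have hcl : IsClosed (convexHull ℝ ((s.erase v : Finset E3) : Set E3)) :=
    ((s.erase v).finite_toSet.isCompact_convexHull ℝ).isClosed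
  obtain ⟨f, u, hfu, huv⟩ := geometric_hahn_banach_closed_point (convex_convexHull ℝ _) hcl hnot
  obtain ⟨b, rfl⟩ := (InnerProductSpace.toDual ℝ E3).surjective f
  simp only [InnerProductSpace.toDual_apply_apply] at hfu huv
  have hle : ∀ x ∈ P, ⟪b, x⟫ ≤ ⟪b, v⟫ := by
    have hconv : Convex ℝ {x : E3 | ⟪b, x⟫ ≤ ⟪b, v⟫} :=
      convex_halfSpace_le (innerSL ℝ b).isLinear _
    refine fun x hx => convexHull_min (fun y hy => ?_) hconv hx
    by_cases hyv : y = v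
    · rw [hyv]; exact le_refl ⟪b, v⟫
    · exact ((hfu y (subset_convexHull ℝ _ (by simp [hyv]; exact hy))).trans huv).le
  intro _
  refine ⟨innerSL ℝ b, ?_⟩
  ext x
  simp only [Set.mem_singleton_iff, Set.mem_ofPred_eq, innerSL_apply_apply]
  constructor
  · rintro rfl; exact ⟨hvP, hle⟩
  · rintro ⟨hx, hxm⟩
    have hxe : ⟪b, x⟫ = ⟪b, v⟫ := le_antisymm (hle x hx) (hxm v hvP)
    by_contra hne
    have hs : (s : Set E3) ⊆ insert v ((s.erase v : Finset E3) : Set E3) := by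
      intro y hy
      by_cases hyv : y = v
      · simp [hyv]
      · right; simp [hyv]; exact hy
    have hx' := convexHull_mono (𝕜 := ℝ) hs hx
    by_cases hemp : ((s.erase v : Finset E3) : Set E3).Nonempty
    · rw [convexHull_insert hemp, mem_convexJoin] at hx'
      obtain ⟨v', hv', y, hy, α, β, hα, hβ, hαβ, hxy⟩ := hx'
      rw [Set.mem_singleton_iff] at hv'
      subst v'
      have h1 := (hfu y hy).trans huv
      rw [← hxy, inner_add_right, real_inner_smul_right, real_inner_smul_right] at hxe
      have hβ0 : β = 0 := by
        by_contra hβ0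
        have : 0 < β := lt_of_le_of_ne hβ (Ne.symm hβ0)
        have hα' : α = 1 - β := by linarith
        subst hα'
        nlinarith
      apply hne
      rw [← hxy, hβ0, show α = 1 by linarith]; simp
    · rw [Set.not_nonempty_iff_eq_empty] at hemp
      rw [hemp] at hx'
      simp at hx'
      exact hne hx'

lemma exists_vertex_mem {s : Finset E3} {F : Set E3}
    (hF : IsExposed ℝ (convexHull ℝ (s : Set E3)) F) (hne : F.Nonempty) :
    ∃ v ∈ F, IsFaceOfDim (convexHull ℝ (s : Set E3)) 0 {v} := by
  have hP : IsCompact (convexHull ℝ (s : Set E3)) := s.finite_toSet.isCompact_convexHull ℝ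
  obtain ⟨v, hv⟩ := (hF.isCompact hP).extremePoints_nonempty hne
  exact ⟨v, extremePoints_subset hv, isFaceOfDim_zero_of_mem_extremePoints
    (hF.isExtreme.extremePoints_subset_extremePoints hv)⟩

lemma finite_vertices (s : Finset E3) :
    {v : E3 | IsFaceOfDim (convexHull ℝ (s : Set E3)) 0 {v}}.Finite :=
  s.finite_toSet.subset fun _ hv =>
    extremePoints_convexHull_subset (mem_extremePoints_of_isFaceOfDim_zero hv)

/-- An inward normal vanishing on an interior direction is zero. -/
lemma inwardNormals_eq_zero {P : Set E3} {v p a : E3} (hp : p ∈ interior P)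
    (ha : a ∈ inwardNormals P v) (h : ⟪a, p - v⟫ = 0) : a = 0 := by
  obtain ⟨r, hr, hball⟩ := Metric.mem_nhds_iff.1 (mem_interior_iff_mem_nhds.1 hp)
  by_contra hne
  have hpos : 0 < ‖a‖ := norm_pos_iff.2 hne
  have hmem : p - (r / 2 / ‖a‖) • a ∈ P := by
    apply hball
    rw [mem_ball_iff_norm, sub_sub_cancel_left, norm_neg, norm_smul, Real.norm_eq_abs,
      abs_of_pos (by positivity), div_mul_cancel₀ _ hpos.ne']
    linarith
  have h1 := ha _ hmem
  rw [sub_right_comm, inner_sub_right, h, real_inner_smul_right, real_inner_self_eq_norm_sq] at h1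
  have : 0 < r / 2 / ‖a‖ * ‖a‖ ^ 2 := by positivity
  linarith

/-- A compact base of the inward normal cone. -/
def normalBase (P : Set E3) (v p : E3) : Set E3 :=
  {a ∈ inwardNormals P v | ⟪a, p - v⟫ = 1}

lemma convex_normalBase (P : Set E3) (v p : E3) : Convex ℝ (normalBase P v p) := by
  rintro a ⟨ha, ha1⟩ b ⟨hb, hb1⟩ α β hα hβ hαβ
  refine ⟨fun x hx => ?_, ?_⟩
  · have := ha x hx; have := hb x hx
    rw [inner_add_left, real_inner_smul_left, real_inner_smul_left]; positivity
  · rw [inner_add_left, real_inner_smul_left, real_inner_smul_left, ha1, hb1]; linarith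

lemma isCompact_normalBase {P : Set E3} {v p : E3} (hp : p ∈ interior P) :
    IsCompact (normalBase P v p) := by
  obtain ⟨r, hr, hball⟩ := Metric.mem_nhds_iff.1 (mem_interior_iff_mem_nhds.1 hp)
  refine Metric.isCompact_of_isClosed_isBounded ?_ ?_
  · have : normalBase P v p = (⋂ x ∈ P, {a | 0 ≤ ⟪a, x - v⟫}) ∩ {a | ⟪a, p - v⟫ = 1} := by
      ext a; simp [normalBase, inwardNormals]
    rw [this]
    refine IsClosed.inter (isClosed_biInter fun x _ => ?_) ?_
    · exact isClosed_le continuous_const (by fun_prop)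
    · exact isClosed_eq (by fun_prop) continuous_const
  · refine (Metric.isBounded_closedBall (x := (0 : E3)) (r := 2 / r)).subset ?_
    rintro a ⟨ha, ha1⟩
    rw [mem_closedBall_zero_iff]
    by_cases hne : a = 0
    · subst hne; simp; positivity
    have hpos : 0 < ‖a‖ := norm_pos_iff.2 hne
    have hmem : p - (r / 2 / ‖a‖) • a ∈ P := by
      apply hball
      rw [mem_ball_iff_norm, sub_sub_cancel_left, norm_neg, norm_smul, Real.norm_eq_abs,
        abs_of_pos (by positivity), div_mul_cancel₀ _ hpos.ne']
      linarith
    have h1 := ha _ hmem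
    rw [sub_right_comm, inner_sub_right, ha1, real_inner_smul_right,
      real_inner_self_eq_norm_sq] at h1
    have h2 : r / 2 / ‖a‖ * ‖a‖ ^ 2 = r / 2 * ‖a‖ := by field_simp
    rw [le_div_iff₀ hr]
    linarith

lemma vectorSpan_levelFace_le {P : Set E3} {v a : E3} :
    vectorSpan ℝ (levelFace P v a) ≤ (ℝ ∙ a)ᗮ := by
  rw [vectorSpan_def, Submodule.span_le]
  rintro _ ⟨x, hx, y, hy, rfl⟩
  rw [SetLike.mem_coe, Submodule.mem_orthogonal_singleton_iff_inner_right]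
  have : x - y = (x - v) - (y - v) := by abel
  simp only [vsub_eq_sub]
  rw [this, inner_sub_right, hx.2, hy.2, sub_zero]

lemma finrank_orthogonal_span {a : E3} (ha : a ≠ 0) : Module.finrank ℝ (ℝ ∙ a)ᗮ = 2 := by
  have : Fact (Module.finrank ℝ E3 = 2 + 1) := ⟨by simp⟩
  exact Submodule.finrank_orthogonal_span_singleton ha

/-- An extreme point of the normal base exposes a facet: a vector orthogonal to the exposed face but
not proportional to `a` would allow moving `a` within the base in two opposite directions. -/
lemma vectorSpan_levelFace_of_extreme {s : Finset E3} {v p a : E3}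
    (hv : v ∈ convexHull ℝ (s : Set E3))
    (ha : a ∈ (normalBase (convexHull ℝ (s : Set E3)) v p).extremePoints ℝ) :
    vectorSpan ℝ (levelFace (convexHull ℝ (s : Set E3)) v a) = (ℝ ∙ a)ᗮ := by
  set P := convexHull ℝ (s : Set E3) with hP
  obtain ⟨ha1, hap⟩ := extremePoints_subset ha
  refine le_antisymm vectorSpan_levelFace_le ?_
  set V := vectorSpan ℝ (levelFace P v a) with hV
  rw [← Submodule.orthogonal_le_orthogonal_iff, Submodule.orthogonal_orthogonal]
  intro b hb
  obtain ⟨b', hb'⟩ : ∃ b', b' = b - ⟪b, p - v⟫ • a := ⟨_, rfl⟩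
  have hvF : v ∈ levelFace P v a := ⟨hv, by simp⟩
  have hbF : ∀ x ∈ P, ⟪a, x - v⟫ = 0 → ⟪b', x - v⟫ = 0 := by
    intro x hx h0
    have hxF : x ∈ levelFace P v a := ⟨hx, h0⟩
    have h1 : x - v ∈ V := vsub_mem_vectorSpan ℝ hxF hvF
    have h2 := (Submodule.mem_orthogonal' _ _).1 hb _ h1
    rw [hb', inner_sub_left, real_inner_smul_left, h2, h0]; simp
  have hb'p : ⟪b', p - v⟫ = 0 := by
    rw [hb', inner_sub_left, real_inner_smul_left, hap]; simp
  obtain ⟨K, hK, hKm⟩ := exists_nonneg_add_smul (m := b') ha1 (fun x hx h => (hbF x hx h).ge)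
  obtain ⟨K', hK', hKm'⟩ := exists_nonneg_add_smul (m := -b') ha1 (fun x hx h => by
    rw [inner_neg_left, hbF x hx h, neg_zero])
  have hmem : a + K⁻¹ • b' ∈ normalBase P v p := by
    refine ⟨fun x hx => ?_, by rw [inner_add_left, real_inner_smul_left, hap, hb'p]; simp⟩
    have := hKm x hx
    have h3 : a + K⁻¹ • b' = K⁻¹ • (b' + K • a) := by
      rw [smul_add, smul_smul, inv_mul_cancel₀ hK.ne', one_smul, add_comm]
    rw [h3, real_inner_smul_left]; positivity
  have hmem' : a - K'⁻¹ • b' ∈ normalBase P v p := by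
    refine ⟨fun x hx => ?_, by rw [inner_sub_left, real_inner_smul_left, hap, hb'p]; simp⟩
    have := hKm' x hx
    have h3 : a - K'⁻¹ • b' = K'⁻¹ • (-b' + K' • a) := by
      rw [smul_add, smul_smul, inv_mul_cancel₀ hK'.ne', one_smul, smul_neg, add_comm, sub_eq_add_neg]
    rw [h3, real_inner_smul_left]; positivity
  have hseg : a ∈ openSegment ℝ (a + K⁻¹ • b') (a - K'⁻¹ • b') := by
    refine ⟨K / (K + K'), K' / (K + K'), by positivity, by positivity, by field_simp, ?_⟩
    rw [smul_add, smul_sub, smul_smul, smul_smul]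
    have e1 : K / (K + K') * K⁻¹ = 1 / (K + K') := by field_simp
    have e2 : K' / (K + K') * K'⁻¹ = 1 / (K + K') := by field_simp
    have e3 : K / (K + K') + K' / (K + K') = 1 := by field_simp
    rw [e1, e2, add_add_sub_cancel, ← add_smul, e3, one_smul]
  have h4 := (mem_extremePoints.1 ha).2 _ hmem _ hmem' hseg
  have hb0 : K⁻¹ • b' = 0 := by simpa using h4.1
  have hb0' : b' = 0 := by
    rcases smul_eq_zero.1 hb0 with h | h
    · exact absurd h (inv_pos.2 hK).ne'
    · exact h
  rw [hb', sub_eq_zero] at hb0'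
  rw [hb0']
  exact Submodule.smul_mem _ _ (Submodule.mem_span_singleton_self a)

/-! ### The simplicial cone at a vertex -/

/-- Local coordinates of a simple 3-polytope `P` at a vertex `v`: the inward normals `normal i` of
the three facets at `v`, and the three neighbours `nb k` of `v`, where the edge towards `nb k` lies
in the facets with normals `normal i`, `i ≠ k`. The normals are scaled so that
`(⟪normal i, x - v⟫)ᵢ` are the coordinates of `x - v` in the basis `(nb k - v)ₖ`; `le_one` says
that the edge does not extend beyond `nb k`. -/
structure VertexChart {P : Set E3} (v : PVertex P) where
  normal : Fin 3 → E3
  nb : Fin 3 → PVertex P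
  normal_mem : ∀ i, normal i ∈ inwardNormals P v
  inner_nb : ∀ i k, ⟪normal i, (nb k : E3) - v⟫ = if i = k then 1 else 0
  eq_zero : ∀ y, (∀ i, ⟪normal i, y⟫ = 0) → y = 0
  le_one : ∀ k, ∀ x ∈ P, (∀ i, i ≠ k → ⟪normal i, x - v⟫ = 0) → ⟪normal k, x - v⟫ ≤ 1
  facet_iff : ∀ F, (IsFaceOfDim P 2 F ∧ (v : E3) ∈ F) ↔ ∃ i, levelFace P v (normal i) = F

lemma span_normalBase {s : Finset E3} {v p : E3} (hp : p ∈ interior (convexHull ℝ (s : Set E3)))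
    (hv : IsFaceOfDim (convexHull ℝ (s : Set E3)) 0 {v}) :
    Submodule.span ℝ (normalBase (convexHull ℝ (s : Set E3)) v p) = ⊤ := by
  set P := convexHull ℝ (s : Set E3) with hP
  have hD : ∀ a ∈ inwardNormals P v, a ∈ Submodule.span ℝ (normalBase P v p) := by
    intro a ha
    have h0 := ha p (interior_subset hp)
    rcases h0.eq_or_lt with h | h
    · rw [inwardNormals_eq_zero hp ha h.symm]; exact Submodule.zero_mem _
    · have : a = ⟪a, p - v⟫ • (⟪a, p - v⟫⁻¹ • a) := by
        rw [smul_smul, mul_inv_cancel₀ h.ne', one_smul]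
      rw [this]
      refine Submodule.smul_mem _ _ (Submodule.subset_span ⟨fun x hx => ?_, ?_⟩)
      · have := ha x hx
        rw [real_inner_smul_left]; positivity
      · rw [real_inner_smul_left, inv_mul_cancel₀ h.ne']
  obtain ⟨a0, ha0, hva0⟩ := exists_levelFace_eq hv.2.1 (Set.mem_singleton v)
  rw [eq_top_iff]
  intro f _
  obtain ⟨K, hK, hKm⟩ := exists_nonneg_add_smul (m := f) ha0 (fun x hx h => by
    have hx' : x ∈ levelFace P v a0 := ⟨hx, h⟩
    rw [← hva0, Set.mem_singleton_iff] at hx'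
    simp [hx'])
  have : f = (f + K • a0) - K • a0 := by abel
  rw [this]
  exact Submodule.sub_mem _ (hD _ hKm) (Submodule.smul_mem _ _ (hD _ ha0))

/-- At a vertex lying in exactly three facets, the cone of inward normals is spanned by three
linearly independent vectors, which are the normals of these facets. -/
lemma exists_basis_normals {s : Finset E3} {v p : E3}
    (hp : p ∈ interior (convexHull ℝ (s : Set E3)))
    (hv : IsFaceOfDim (convexHull ℝ (s : Set E3)) 0 {v})
    (h3 : {F : Set E3 | IsFaceOfDim (convexHull ℝ (s : Set E3)) 2 F ∧ v ∈ F}.ncard = 3) :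
    ∃ a : Fin 3 → E3, LinearIndependent ℝ a ∧
      (∀ i, a i ∈ inwardNormals (convexHull ℝ (s : Set E3)) v) ∧
      (∀ f ∈ inwardNormals (convexHull ℝ (s : Set E3)) v,
        ∃ c : Fin 3 → ℝ, (∀ i, 0 ≤ c i) ∧ f = ∑ i, c i • a i) ∧
      ∀ F, (IsFaceOfDim (convexHull ℝ (s : Set E3)) 2 F ∧ v ∈ F) ↔
        ∃ i, levelFace (convexHull ℝ (s : Set E3)) v (a i) = F := by
  classical
  set P := convexHull ℝ (s : Set E3) with hP
  have hvP : v ∈ P := hv.2.1.subset (Set.mem_singleton v)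
  set A := (normalBase P v p).extremePoints ℝ with hA
  set T := {F : Set E3 | IsFaceOfDim P 2 F ∧ v ∈ F} with hT
  have hTfin : T.Finite := Set.finite_of_ncard_ne_zero (by rw [h3]; norm_num)
  have hAB : A ⊆ normalBase P v p := extremePoints_subset
  have hne : ∀ a ∈ A, a ≠ 0 := by
    rintro a ha rfl
    simpa using (hAB ha).2
  have hmaps : ∀ a ∈ A, levelFace P v a ∈ T := by
    intro a ha
    have hvF : v ∈ levelFace P v a := ⟨hvP, by simp⟩
    exact ⟨⟨⟨v, hvF⟩, isExposed_levelFace hvP (hAB ha).1, by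
      rw [vectorSpan_levelFace_of_extreme hvP ha, finrank_orthogonal_span (hne a ha)]⟩, hvF⟩
  have hinj : Set.InjOn (levelFace P v) A := by
    intro a ha b hb hab
    have h1 : (ℝ ∙ a)ᗮ = (ℝ ∙ b)ᗮ := by
      rw [← vectorSpan_levelFace_of_extreme hvP ha, ← vectorSpan_levelFace_of_extreme hvP hb, hab]
    have h2 : (ℝ ∙ a) = (ℝ ∙ b) := by
      rw [← Submodule.orthogonal_orthogonal (ℝ ∙ a), h1, Submodule.orthogonal_orthogonal]
    have h4 : a ∈ (ℝ ∙ b) := h2 ▸ Submodule.mem_span_singleton_self a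
    obtain ⟨t, rfl⟩ := Submodule.mem_span_singleton.1 h4
    have h5 := (hAB ha).2
    rw [real_inner_smul_left, (hAB hb).2, mul_one] at h5
    rw [h5, one_smul]
  have hAfin : A.Finite := Set.Finite.of_finite_image (hTfin.subset (Set.image_subset_iff.2 hmaps))
    hinj
  have hAle : A.ncard ≤ 3 := by
    rw [← h3]; exact Set.ncard_le_ncard_of_injOn _ hmaps hinj hTfin
  have hBA : convexHull ℝ A = normalBase P v p := by
    rw [← closure_convexHull_extremePoints (isCompact_normalBase hp) (convex_normalBase P v p),
      (hAfin.isCompact_convexHull ℝ).isClosed.closure_eq]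
  have hspan : Submodule.span ℝ A = ⊤ := by
    rw [eq_top_iff, ← span_normalBase hp hv, Submodule.span_le, ← hBA]
    exact convexHull_min Submodule.subset_span (Submodule.convex _)
  have hA3 : A.ncard = 3 := by
    refine le_antisymm hAle ?_
    have := finrank_span_finset_le_card (R := ℝ) hAfin.toFinset
    rw [hAfin.coe_toFinset, Set.finrank, hspan, finrank_top, finrank_euclideanSpace_fin,
      ← Set.ncard_eq_toFinset_card A hAfin] at this
    exact this
  have hcard : hAfin.toFinset.card = 3 := by rw [← Set.ncard_eq_toFinset_card A hAfin, hA3]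
  let e := hAfin.toFinset.equivFinOfCardEq hcard
  let a : Fin 3 → E3 := fun i => (e.symm i : E3)
  have haA : ∀ i, a i ∈ A := fun i => hAfin.mem_toFinset.1 (e.symm i).2
  have hrange : Set.range a = A := by
    refine Set.Subset.antisymm (Set.range_subset_iff.2 haA) fun x hx => ?_
    exact ⟨e ⟨x, hAfin.mem_toFinset.2 hx⟩, by simp [a]⟩
  have hainj : Function.Injective a := Subtype.val_injective.comp e.symm.injective
  refine ⟨a, ?_, fun i => (hAB (haA i)).1, ?_, ?_⟩
  · refine linearIndependent_of_top_le_span_of_card_eq_finrank ?_ (by simp)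
    rw [hrange, hspan]
  · have hsub : normalBase P v p ⊆ {f | ∃ c : Fin 3 → ℝ, (∀ i, 0 ≤ c i) ∧ f = ∑ i, c i • a i} := by
      rw [← hBA]
      refine convexHull_min ?_ ?_
      · rw [← hrange]
        rintro _ ⟨i, rfl⟩
        refine ⟨fun j => if j = i then 1 else 0, fun j => by dsimp only; split_ifs <;> norm_num, ?_⟩
        simp
      · rintro _ ⟨c, hc, rfl⟩ _ ⟨d, hd, rfl⟩ α β hα hβ _
        refine ⟨fun i => α * c i + β * d i, fun i => ?_, ?_⟩
        · have := hc i; have := hd i; positivity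
        · simp only [Finset.smul_sum, smul_smul, add_smul, Finset.sum_add_distrib]
    intro f hf
    rcases (hf p (interior_subset hp)).eq_or_lt with h | h
    · exact ⟨0, fun _ => le_rfl, by simp [inwardNormals_eq_zero hp hf h.symm]⟩
    · obtain ⟨c, hc, hcf⟩ := hsub (a := ⟪f, p - v⟫⁻¹ • f) ⟨fun x hx => by
        have := hf x hx
        rw [real_inner_smul_left]; positivity, by
        rw [real_inner_smul_left, inv_mul_cancel₀ h.ne']⟩
      refine ⟨fun i => ⟪f, p - v⟫ * c i, fun i => mul_nonneg h.le (hc i), ?_⟩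
      simp only [mul_smul]
      rw [← Finset.smul_sum, ← hcf, smul_smul, mul_inv_cancel₀ h.ne', one_smul]
  · intro F
    have himg : levelFace P v '' A = T := by
      refine Set.eq_of_subset_of_ncard_le (Set.image_subset_iff.2 hmaps) ?_ hTfin
      rw [hinj.ncard_image, hA3, h3]
    change F ∈ T ↔ _
    rw [← himg, ← hrange]
    simp

lemma mem_levelFace_sum {P : Set E3} {v : E3} {a : Fin 3 → E3}
    (ha : ∀ i, a i ∈ inwardNormals P v) {t : Finset (Fin 3)} {x : E3} (hx : x ∈ P) :
    ⟪∑ i ∈ t, a i, x - v⟫ = 0 ↔ ∀ i ∈ t, ⟪a i, x - v⟫ = 0 := by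
  rw [sum_inner, Finset.sum_eq_zero_iff_of_nonneg fun i _ => ha i x hx]

lemma sum_mem_inwardNormals {P : Set E3} {v : E3} {a : Fin 3 → E3}
    (ha : ∀ i, a i ∈ inwardNormals P v) (t : Finset (Fin 3)) :
    ∑ i ∈ t, a i ∈ inwardNormals P v := by
  intro x hx
  rw [sum_inner]
  exact Finset.sum_nonneg fun i _ => ha i x hx

/-- The far end of the edge from `v` on which the functionals `a i`, `i ≠ k`, vanish. If they
vanished only at points where `a k` vanishes too, then `K • ∑ i ≠ k, a i - a k` would be an inward
normal for some `K`, but its coefficient at `a k` is negative. -/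
lemma exists_far_vertex {s : Finset E3} {v : E3} (hv : v ∈ convexHull ℝ (s : Set E3))
    {a : Fin 3 → E3} (hli : LinearIndependent ℝ a)
    (ha : ∀ i, a i ∈ inwardNormals (convexHull ℝ (s : Set E3)) v)
    (hcone : ∀ f ∈ inwardNormals (convexHull ℝ (s : Set E3)) v,
        ∃ c : Fin 3 → ℝ, (∀ i, 0 ≤ c i) ∧ f = ∑ i, c i • a i)
    (hzero : ∀ y, (∀ i, ⟪a i, y⟫ = 0) → y = 0) (k : Fin 3) :
    ∃ w, IsFaceOfDim (convexHull ℝ (s : Set E3)) 0 {w} ∧ 0 < ⟪a k, w - v⟫ ∧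
      (∀ i, i ≠ k → ⟪a i, w - v⟫ = 0) ∧
      ∀ x ∈ convexHull ℝ (s : Set E3), (∀ i, i ≠ k → ⟪a i, x - v⟫ = 0) →
        ⟪a k, x - v⟫ ≤ ⟪a k, w - v⟫ := by
  set P := convexHull ℝ (s : Set E3) with hP
  have hPc : IsCompact P := s.finite_toSet.isCompact_convexHull ℝ
  set n := ∑ i ∈ Finset.univ.erase k, a i with hn
  have hnm : n ∈ inwardNormals P v := sum_mem_inwardNormals ha _
  set E := levelFace P v n with hE
  have hEexp : IsExposed ℝ P E := isExposed_levelFace hv hnm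
  have hEiff : ∀ x ∈ P, (x ∈ E ↔ ∀ i, i ≠ k → ⟪a i, x - v⟫ = 0) := by
    intro x hx
    have h := mem_levelFace_sum ha (t := Finset.univ.erase k) hx
    simp only [Finset.mem_erase, Finset.mem_univ, and_true] at h
    rw [← h]
    exact ⟨fun h => h.2, fun h => ⟨hx, h⟩⟩
  have hvE : v ∈ E := ⟨hv, by simp⟩
  obtain ⟨w, hwE, hmax⟩ := (hEexp.isCompact hPc).exists_isMaxOn ⟨v, hvE⟩
    (f := fun x => ⟪a k, x - v⟫) (by fun_prop)
  have hwP := hEexp.subset hwE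
  have hpos : 0 < ⟪a k, w - v⟫ := by
    by_contra hle
    have hall : ∀ x ∈ P, ⟪n, x - v⟫ = 0 → 0 ≤ ⟪-a k, x - v⟫ := by
      intro x hx h0
      rw [inner_neg_left]
      have : ⟪a k, x - v⟫ ≤ ⟪a k, w - v⟫ := hmax (a := x) ⟨hx, h0⟩
      linarith
    obtain ⟨K, hK, hKm⟩ := exists_nonneg_add_smul hnm hall
    obtain ⟨c, hc, hcf⟩ := hcone _ hKm
    have h0 : ∑ i, (c i - K + if i = k then K + 1 else 0) • a i = 0 := by
      have h1 : n = ∑ i, a i - a k := Finset.sum_erase_eq_sub (Finset.mem_univ k)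
      simp only [add_smul, sub_smul, ite_smul, zero_smul, Finset.sum_add_distrib,
        Finset.sum_sub_distrib, ← hcf, h1, Finset.sum_ite_eq', Finset.mem_univ, if_true, smul_sub,
        Finset.smul_sum]
      module
    have h1 := Fintype.linearIndependent_iff.1 hli _ h0 k
    have h2 := hc k
    rw [if_pos rfl] at h1
    linarith
  have hw0 := (hEiff w hwP).1 hwE
  refine ⟨w, ?_, hpos, hw0, fun x hx h => hmax (a := x) ((hEiff x hx).2 h)⟩
  refine isFaceOfDim_zero_of_mem_extremePoints (isExtreme_singleton.1 (hEexp.isExtreme.trans ?_))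
  refine IsExposed.isExtreme (fun _ => ⟨innerSL ℝ (a k), ?_⟩)
  ext x
  simp only [Set.mem_singleton_iff, Set.mem_ofPred_eq, innerSL_apply_apply]
  have hmax' : ∀ y ∈ E, ⟪a k, y⟫ ≤ ⟪a k, w⟫ := by
    intro y hy
    have : ⟪a k, y - v⟫ ≤ ⟪a k, w - v⟫ := hmax hy
    rw [inner_sub_right, inner_sub_right] at this
    linarith
  constructor
  · rintro rfl
    exact ⟨hwE, hmax'⟩
  · rintro ⟨hxE, hx⟩
    rw [← sub_eq_zero]
    refine hzero _ fun i => ?_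
    by_cases hik : i = k
    · rw [hik, inner_sub_right, sub_eq_zero]
      exact le_antisymm (hmax' x hxE) (hx w hwE)
    · have h1 := (hEiff x (hEexp.subset hxE)).1 hxE i hik
      have h2 := hw0 i hik
      rw [inner_sub_right] at h1 h2 ⊢
      linarith

lemma nonempty_vertexChart {P : Set E3} (hP : IsSimpleThreePolytope P) (v : PVertex P) :
    Nonempty (VertexChart v) := by
  obtain ⟨s, rfl⟩ := hP.exists_finset
  obtain ⟨p, hp⟩ := hP.interior_nonempty
  obtain ⟨v, hv⟩ := v
  obtain ⟨a, hli, ha, hcone, hfac⟩ := exists_basis_normals hp hv (hP.simple v hv)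
  have hvP := hv.2.1.subset (Set.mem_singleton v)
  have hspan : Submodule.span ℝ (Set.range a) = ⊤ :=
    hli.span_eq_top_of_card_eq_finrank' (by simp)
  have hzero : ∀ y, (∀ i, ⟪a i, y⟫ = 0) → y = 0 := by
    intro y hy
    have : y ∈ (Submodule.span ℝ (Set.range a))ᗮ := by
      rw [Submodule.mem_orthogonal]
      intro u hu
      induction hu using Submodule.span_induction with
      | mem x h => obtain ⟨i, rfl⟩ := h; exact hy i
      | zero => simp
      | add x y _ _ h1 h2 => rw [inner_add_left, h1, h2, add_zero]
      | smul c x _ h => rw [real_inner_smul_left, h, mul_zero]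
    rw [hspan, Submodule.top_orthogonal_eq_bot, Submodule.mem_bot] at this
    exact this
  choose w hw hpos hw0 hwmax using exists_far_vertex hvP hli ha hcone hzero
  refine ⟨⟨fun i => ⟪a i, w i - v⟫⁻¹ • a i, fun k => ⟨w k, hw k⟩, ?_, ?_, ?_, ?_, ?_⟩⟩
  · intro i x hx
    have := ha i x hx
    have := hpos i
    rw [real_inner_smul_left]; positivity
  · intro i k
    rw [real_inner_smul_left]
    split_ifs with h
    · subst h; exact inv_mul_cancel₀ (hpos i).ne'
    · rw [hw0 k i h, mul_zero]
  · intro y hy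
    refine hzero y fun i => ?_
    have := hy i
    rw [real_inner_smul_left] at this
    exact (mul_eq_zero.1 this).resolve_left (inv_pos.2 (hpos i)).ne'
  · intro k x hx h
    rw [real_inner_smul_left, inv_mul_le_iff₀ (hpos k), mul_one]
    refine hwmax k x hx fun i hi => ?_
    have := h i hi
    rw [real_inner_smul_left] at this
    exact (mul_eq_zero.1 this).resolve_left (inv_pos.2 (hpos i)).ne'
  · intro F
    rw [hfac]
    refine exists_congr fun i => ?_
    have : levelFace (convexHull ℝ (s : Set E3)) v (⟪a i, w i - v⟫⁻¹ • a i)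
        = levelFace (convexHull ℝ (s : Set E3)) v (a i) := by
      ext x
      simp only [levelFace, Set.mem_ofPred_eq, real_inner_smul_left, mul_eq_zero,
        (inv_pos.2 (hpos i)).ne', false_or]
    rw [this]

/-! ### Edges and facets at a vertex -/

section Geometry

variable {P : Set E3}

lemma pVertex_mem (v : PVertex P) : (v : E3) ∈ P :=
  v.2.2.1.subset (Set.mem_singleton _)

lemma finite_pVertex (hP : IsSimpleThreePolytope P) : Finite (PVertex P) := by
  obtain ⟨s, rfl⟩ := hP.exists_finset
  exact finite_vertices s

lemma convex_of_isSimpleThreePolytope (hP : IsSimpleThreePolytope P) : Convex ℝ P := by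
  obtain ⟨s, rfl⟩ := hP.exists_finset
  exact convex_convexHull ℝ _

lemma exists_pVertex_mem (hP : IsSimpleThreePolytope P) {F : Set E3} (hF : IsExposed ℝ P F)
    (hne : F.Nonempty) : ∃ v : PVertex P, (v : E3) ∈ F := by
  obtain ⟨s, rfl⟩ := hP.exists_finset
  obtain ⟨v, hvF, hv⟩ := exists_vertex_mem hF hne
  exact ⟨⟨v, hv⟩, hvF⟩

namespace VertexChart

variable {v : PVertex P}

lemma eq_sum (ch : VertexChart v) (y : E3) :
    y = ∑ k, ⟪ch.normal k, y⟫ • ((ch.nb k : E3) - v) := by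
  rw [← sub_eq_zero]
  refine ch.eq_zero _ fun i => ?_
  rw [inner_sub_right, inner_sum, sub_eq_zero]
  simp only [real_inner_smul_right, ch.inner_nb, mul_ite, mul_one, mul_zero, Finset.sum_ite_eq,
    Finset.mem_univ, if_true]

lemma normal_ne_zero (ch : VertexChart v) (i : Fin 3) : ch.normal i ≠ 0 := by
  intro h
  have := ch.inner_nb i i
  simp [h] at this

lemma nb_injective (ch : VertexChart v) : Function.Injective ch.nb := by
  intro i j h
  by_contra hij
  have h1 := ch.inner_nb i i
  rw [h, ch.inner_nb, if_neg hij, if_pos rfl] at h1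
  exact one_ne_zero h1.symm

lemma nb_ne (ch : VertexChart v) (k : Fin 3) : ch.nb k ≠ v := by
  intro h
  have h1 := ch.inner_nb k k
  simp [h] at h1

/-- The facet at `v` opposite to the edge towards `ch.nb i`. -/
def facet (ch : VertexChart v) (i : Fin 3) : PFacet P :=
  ⟨levelFace P v (ch.normal i), ((ch.facet_iff _).2 ⟨i, rfl⟩).1⟩

lemma mem_facet (ch : VertexChart v) (i : Fin 3) : (v : E3) ∈ (ch.facet i : Set E3) :=
  ((ch.facet_iff _).2 ⟨i, rfl⟩).2

lemma exists_facet_eq (ch : VertexChart v) {F : PFacet P} (h : (v : E3) ∈ (F : Set E3)) :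
    ∃ i, ch.facet i = F := by
  obtain ⟨i, hi⟩ := (ch.facet_iff F).1 ⟨F.2, h⟩
  exact ⟨i, Subtype.ext hi⟩

lemma nb_mem_facet (ch : VertexChart v) {i k : Fin 3} :
    (ch.nb k : E3) ∈ (ch.facet i : Set E3) ↔ i ≠ k := by
  change _ ∧ _ ↔ _
  rw [ch.inner_nb]
  simp [pVertex_mem]

lemma facet_injective (ch : VertexChart v) : Function.Injective ch.facet := by
  intro i j h
  by_contra hij
  have h1 := ch.nb_mem_facet.2 hij
  rw [h] at h1
  exact ch.nb_mem_facet.1 h1 rfl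

/-- The intersection of the facets other than the `k`-th is the edge towards `ch.nb k`; the sum of
their normals exposes it. -/
lemma levelFace_sum_eq_segment (hP : Convex ℝ P) (ch : VertexChart v) (k : Fin 3) :
    levelFace P v (∑ i ∈ Finset.univ.erase k, ch.normal i) = segment ℝ (v : E3) (ch.nb k) := by
  ext x
  have hsum : ∀ x ∈ P, (⟪∑ i ∈ Finset.univ.erase k, ch.normal i, x - v⟫ = 0 ↔
      ∀ i, i ≠ k → ⟪ch.normal i, x - v⟫ = 0) := by
    intro x hx
    rw [mem_levelFace_sum ch.normal_mem hx]
    simp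
  constructor
  · rintro ⟨hx, h0⟩
    have h1 := (hsum x hx).1 h0
    have h2 := ch.eq_sum (x - v)
    rw [Finset.sum_eq_single k (fun i _ hi => by rw [h1 i hi, zero_smul]) (by simp)] at h2
    rw [segment_eq_image']
    exact ⟨_, ⟨ch.normal_mem k x hx, ch.le_one k x hx h1⟩, by dsimp only; rw [← h2]; abel⟩
  · intro hx
    have hxP : x ∈ P := hP.segment_subset (pVertex_mem v) (pVertex_mem _) hx
    refine ⟨hxP, (hsum x hxP).2 fun i hi => ?_⟩
    rw [segment_eq_image'] at hx
    obtain ⟨t, _, rfl⟩ := hx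
    dsimp only
    rw [add_sub_cancel_left, real_inner_smul_right, ch.inner_nb, if_neg hi, mul_zero]

end VertexChart

lemma finrank_vectorSpan_segment {x y : E3} (h : x ≠ y) :
    Module.finrank ℝ (vectorSpan ℝ (segment ℝ x y)) = 1 := by
  rw [← convexHull_pair, ← direction_affineSpan, affineSpan_convexHull, direction_affineSpan, vectorSpan_pair]
  exact finrank_span_singleton (by simpa [sub_eq_zero] using h)

namespace VertexChart

variable {v : PVertex P}

lemma adj_nb (hP : Convex ℝ P) (ch : VertexChart v) (k : Fin 3) :
    (edgeGraph P).Adj v (ch.nb k) := by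
  refine ⟨(ch.nb_ne k).symm, ⟨v, left_mem_segment ℝ _ _⟩, ?_, ?_⟩
  · rw [← ch.levelFace_sum_eq_segment hP]
    exact isExposed_levelFace (pVertex_mem v) (sum_mem_inwardNormals ch.normal_mem _)
  · exact finrank_vectorSpan_segment fun h => ch.nb_ne k (Subtype.ext h.symm)

/-- The only edges at `v` are those towards the three neighbours of the chart. -/
lemma exists_nb_eq (ch : VertexChart v) {w : PVertex P} (h : (edgeGraph P).Adj v w) :
    ∃ k, ch.nb k = w := by
  obtain ⟨hne, _, hexp, _⟩ := h
  obtain ⟨a, ha, hseg⟩ := exists_levelFace_eq hexp (left_mem_segment ℝ (v : E3) w)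
  have hw0 : ⟪a, (w : E3) - v⟫ = 0 := by
    have := right_mem_segment ℝ (v : E3) w
    rw [hseg] at this
    exact this.2
  have hsum := ch.eq_sum ((w : E3) - v)
  have hk : ∃ k, ⟪ch.normal k, (w : E3) - v⟫ ≠ 0 := by
    by_contra! hall
    exact hne (Subtype.ext (sub_eq_zero.1 (ch.eq_zero _ hall)).symm)
  obtain ⟨k, hk⟩ := hk
  have hzero : ∀ i, ⟪ch.normal i, (w : E3) - v⟫ * ⟪a, (ch.nb i : E3) - v⟫ = 0 := by
    have h1 : ∑ i, ⟪ch.normal i, (w : E3) - v⟫ * ⟪a, (ch.nb i : E3) - v⟫ = 0 := by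
      rw [hsum, inner_sum] at hw0
      simpa only [real_inner_smul_right] using hw0
    rw [Finset.sum_eq_zero_iff_of_nonneg fun i _ =>
      mul_nonneg (ch.normal_mem i w (pVertex_mem w)) (ha _ (pVertex_mem _))] at h1
    exact fun i => h1 i (Finset.mem_univ i)
  have hmem : (ch.nb k : E3) ∈ segment ℝ (v : E3) w := by
    rw [hseg]
    exact ⟨pVertex_mem _, (mul_eq_zero.1 (hzero k)).resolve_left hk⟩
  refine ⟨k, ?_⟩
  rcases (mem_extremePoints_iff_forall_segment.1
    (mem_extremePoints_of_isFaceOfDim_zero (ch.nb k).2)).2 v (pVertex_mem v) w (pVertex_mem w) hmem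
    with h1 | h1
  · exact absurd (Subtype.ext h1.symm) (ch.nb_ne k)
  · exact Subtype.ext h1.symm

end VertexChart

lemma mem_segment_pVertex {u v w : PVertex P} (h : (u : E3) ∈ segment ℝ (v : E3) w) :
    u = v ∨ u = w := by
  rcases (mem_extremePoints_iff_forall_segment.1
    (mem_extremePoints_of_isFaceOfDim_zero u.2)).2 v (pVertex_mem v) w (pVertex_mem w) h
    with h1 | h1
  · exact Or.inl (Subtype.ext h1.symm)
  · exact Or.inr (Subtype.ext h1.symm)

/-- Distinct edges do not meet in a relative interior point of one of them. -/
lemma eq_or_eq_of_mem_openSegment {v w v' w' : PVertex P} (h : (edgeGraph P).Adj v w)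
    (h' : (edgeGraph P).Adj v' w') {x : E3} (hx : x ∈ openSegment ℝ (v : E3) w)
    (hx' : x ∈ segment ℝ (v' : E3) w') : (v = v' ∧ w = w') ∨ (v = w' ∧ w = v') := by
  have hv : (v : E3) ∈ segment ℝ (v' : E3) w' :=
    h'.2.2.1.isExtreme.2 (pVertex_mem v) (pVertex_mem w) hx' hx
  have hw : (w : E3) ∈ segment ℝ (v' : E3) w' :=
    h'.2.2.1.isExtreme.right_mem_of_mem_openSegment (pVertex_mem v) (pVertex_mem w) hx' hx
  have hne : v ≠ w := h.1
  rcases mem_segment_pVertex hv with rfl | rfl <;> rcases mem_segment_pVertex hw with rfl | rfl <;>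
    simp_all

lemma segment_subset_frontier (hP : IsSimpleThreePolytope P) {v w : PVertex P}
    (h : (edgeGraph P).Adj v w) : segment ℝ (v : E3) w ⊆ frontier P := by
  obtain ⟨ch⟩ := nonempty_vertexChart hP v
  obtain ⟨k, rfl⟩ := ch.exists_nb_eq h
  have hconv := convex_of_isSimpleThreePolytope hP
  intro x hx
  have hxP : x ∈ P := hconv.segment_subset (pVertex_mem v) (pVertex_mem _) hx
  refine ⟨subset_closure hxP, fun hint => ?_⟩
  obtain ⟨i, hi⟩ := exists_ne k
  refine ch.normal_ne_zero i (inwardNormals_eq_zero hint (ch.normal_mem i) ?_)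
  rw [segment_eq_image'] at hx
  obtain ⟨t, _, rfl⟩ := hx
  rw [add_sub_cancel_left, real_inner_smul_right, ch.inner_nb, if_neg hi, mul_zero]

/-- A linear functional separating the vertices. -/
lemma exists_injective_height (hP : IsSimpleThreePolytope P) :
    ∃ f : E3 →ₗ[ℝ] ℝ, Function.Injective fun v : PVertex P => f v := by
  have := finite_pVertex hP
  obtain ⟨f, hf⟩ := Module.exists_dual_forall_apply_ne_zero (K := ℝ)
    (fun p : {p : PVertex P × PVertex P // p.1 ≠ p.2} => (p.1.1 : E3) - p.1.2)
    (fun p h => p.2 (Subtype.ext (sub_eq_zero.1 h)))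
  refine ⟨f, fun v w h => ?_⟩
  by_contra hne
  exact hf ⟨(v, w), hne⟩ (by rw [map_sub, sub_eq_zero]; exact h)

/-- If `f` does not decrease along the edges of a face at `v`, then `v` minimises `f` on the face:
the face is contained in the cone spanned by these edges. -/
lemma VertexChart.le_of_forall_nb {v : PVertex P} (ch : VertexChart v) (f : E3 →ₗ[ℝ] ℝ) {x : E3}
    (hx : x ∈ P) (h : ∀ k, ⟪ch.normal k, x - v⟫ ≠ 0 → f v ≤ f (ch.nb k)) : f v ≤ f x := by
  have h1 : f (x - v) = ∑ k, ⟪ch.normal k, x - v⟫ * (f (ch.nb k) - f v) := by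
    conv_lhs => rw [ch.eq_sum (x - v)]
    simp
  have h2 : 0 ≤ f (x - v) := by
    rw [h1]
    refine Finset.sum_nonneg fun k _ => ?_
    by_cases h0 : ⟪ch.normal k, x - v⟫ = 0
    · rw [h0, zero_mul]
    · exact mul_nonneg (ch.normal_mem k x hx) (sub_nonneg.2 (h k h0))
  rw [map_sub] at h2
  linarith

end Geometry

/-! ### Edge colourings induced by facet colourings -/

section Cochains

variable {P : Set E3} {A : Type*} [CommRing A]

/-- The facet colouring `c` induces the edge colouring `x` at the vertex `w`: on every edge at `w`,
the value of `x` is the sum of the colours of the two facets containing the edge. -/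
def InducesAt (c : PFacet P → A) (x : PVertex P → PVertex P → A) (w : PVertex P) : Prop :=
  ∀ u, (edgeGraph P).Adj w u → ∀ F G : PFacet P, F ≠ G → (w : E3) ∈ (F : Set E3) →
    (w : E3) ∈ (G : Set E3) → (u : E3) ∈ (F : Set E3) → (u : E3) ∈ (G : Set E3) →
    c F + c G = x w u

lemma VertexChart.inducesAt {v : PVertex P} (ch : VertexChart v) {c : PFacet P → A}
    {x : PVertex P → PVertex P → A} (h : ∀ i j k, i ≠ j → i ≠ k → j ≠ k →
      c (ch.facet i) + c (ch.facet j) = x v (ch.nb k)) : InducesAt c x v := by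
  intro u hu F G hFG hvF hvG huF huG
  obtain ⟨k, rfl⟩ := ch.exists_nb_eq hu
  obtain ⟨i, rfl⟩ := ch.exists_facet_eq hvF
  obtain ⟨j, rfl⟩ := ch.exists_facet_eq hvG
  exact h i j k (fun hij => hFG (hij ▸ rfl)) (ch.nb_mem_facet.1 huF) (ch.nb_mem_facet.1 huG)

/-- Extension step at a vertex: `y` are the colours of the three facets at the vertex, `z` the
prescribed values on the opposite edges, and `D` tells which edges go down. The facets containing a
down edge keep their colours. -/
lemma exists_extension (h2 : (2 : A) = 0) (y z : Fin 3 → A) (D : Fin 3 → Prop)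
    (hz : ∀ i j k, i ≠ j → i ≠ k → j ≠ k → z i + z j + z k = 0)
    (hD : ∀ i j k, i ≠ j → i ≠ k → j ≠ k → D k → y i + y j = z k) :
    ∃ y' : Fin 3 → A, (∀ i, (∃ k, k ≠ i ∧ D k) → y' i = y i) ∧
      ∀ i j k, i ≠ j → i ≠ k → j ≠ k → y' i + y' j = z k := by
  -- All solutions of the equations are of the form `z + t` with `t` constant.
  have hsol : ∀ t : A, ∀ i j k, i ≠ j → i ≠ k → j ≠ k → (z i + t) + (z j + t) = z k := by
    intro t i j k hij hik hjk
    linear_combination hz i j k hij hik hjk + (t - z k) * h2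
  by_cases hex : ∃ i k, k ≠ i ∧ D k
  · obtain ⟨i, hi⟩ := hex
    refine ⟨fun l => z l + (y i + z i), fun j hj => ?_, hsol _⟩
    dsimp only
    by_cases hij : i = j
    · subst hij; linear_combination z i * h2
    obtain ⟨m, him, hjm⟩ : ∃ m, i ≠ m ∧ j ≠ m := by
      clear hi hj
      revert i j; decide
    by_cases hm : D m
    · linear_combination hz i j m hij him hjm + hD i j m hij him hjm hm - y j * h2
    · have third : ∀ a b c d : Fin 3, a ≠ b → a ≠ c → b ≠ c → d ≠ a → d ≠ c → d = b := by
        omega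
      have hDj : D j := by
        obtain ⟨k, hk, hDk⟩ := hi
        have hkm : k ≠ m := fun h => hm (h ▸ hDk)
        rwa [← third i j m k hij him hjm hk hkm]
      have hDi : D i := by
        obtain ⟨k, hk, hDk⟩ := hj
        have hkm : k ≠ m := fun h => hm (h ▸ hDk)
        rwa [← third j i m k (Ne.symm hij) hjm him hk hkm]
      have e1 := hD i m j him hij (Ne.symm hjm) hDj
      have e2 := hD j m i hjm (Ne.symm hij) (Ne.symm him) hDi
      linear_combination e1 - e2 + z j * h2
  · exact ⟨fun l => z l + 0, fun i hi => absurd ⟨i, hi⟩ hex, hsol 0⟩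

/-- A symmetric function on edges that sums to zero around every vertex is induced by a colouring
of the facets. The facets are coloured while the vertices are swept by a generic linear functional:
a facet has a unique local minimum, so it is first met at its lowest vertex, and the values on the
edges going down from a vertex are already right. -/
theorem exists_inducesAt (hP : IsSimpleThreePolytope P) (h2 : (2 : A) = 0)
    (x : PVertex P → PVertex P → A) (hsymm : ∀ v w, x v w = x w v)
    (hsum : ∀ (v : PVertex P) (ch : VertexChart v), ∑ k, x v (ch.nb k) = 0) :
    ∃ c : PFacet P → A, ∀ v, InducesAt c x v := by
  classical
  have := finite_pVertex hP
  have := Fintype.ofFinite (PVertex P)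
  obtain ⟨f, hf⟩ := exists_injective_height hP
  suffices h : ∀ s : Finset (PVertex P), (∀ v ∈ s, ∀ w : PVertex P, f w ≤ f v → w ∈ s) →
      ∃ c : PFacet P → A, ∀ v ∈ s, InducesAt c x v by
    obtain ⟨c, hc⟩ := h Finset.univ (fun _ _ _ _ => Finset.mem_univ _)
    exact ⟨c, fun v => hc v (Finset.mem_univ v)⟩
  intro s
  induction s using Finset.induction_on_max_value (fun v : PVertex P => f v) with
  | empty => exact fun _ => ⟨0, by simp⟩
  | insert a s ha hmax ih =>
    intro hlow
    have hlt : ∀ w : PVertex P, f w < f a → w ∈ s := by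
      intro w hw
      rcases Finset.mem_insert.1 (hlow a (Finset.mem_insert_self a s) w hw.le) with rfl | h
      · exact absurd hw (lt_irrefl _)
      · exact h
    have hlt' : ∀ w ∈ s, f w < f a := fun w hw =>
      lt_of_le_of_ne (hmax w hw) fun h => ha (hf h ▸ hw)
    obtain ⟨c, hc⟩ := ih fun v hv w hw => hlt w (hw.trans_lt (hlt' v hv))
    obtain ⟨ch⟩ := nonempty_vertexChart hP a
    have hconv := convex_of_isSimpleThreePolytope hP
    have hz : ∀ i j k, i ≠ j → i ≠ k → j ≠ k →
        x a (ch.nb i) + x a (ch.nb j) + x a (ch.nb k) = 0 := by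
      intro i j k hij hik hjk
      have huniv : (Finset.univ : Finset (Fin 3)) = {i, j, k} := by
        revert i j k; decide
      rw [← hsum a ch, huniv, Finset.sum_insert (by simp [hij, hik]), Finset.sum_pair hjk, add_assoc]
    obtain ⟨y', hy', hyz⟩ := exists_extension h2 (fun i => c (ch.facet i))
      (fun k => x a (ch.nb k)) (fun k => f (ch.nb k) < f a) hz (fun i j k hij hik hjk hk => by
        rw [hsymm]
        exact hc _ (hlt _ hk) a (ch.adj_nb hconv k).symm _ _ (ch.facet_injective.ne hij)
          (ch.nb_mem_facet.2 hik) (ch.nb_mem_facet.2 hjk) (ch.mem_facet i) (ch.mem_facet j))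
    let c' : PFacet P → A := fun F => if h : ∃ i, ch.facet i = F then y' h.choose else c F
    have hc'a : ∀ i, c' (ch.facet i) = y' i := by
      intro i
      have h : ∃ j, ch.facet j = ch.facet i := ⟨i, rfl⟩
      simp only [c', dif_pos h]
      rw [ch.facet_injective h.choose_spec]
    have hc'c : ∀ F : PFacet P, ∀ u ∈ s, (u : E3) ∈ (F : Set E3) → c' F = c F := by
      intro F u hu huF
      by_cases h : ∃ i, ch.facet i = F
      · obtain ⟨i, rfl⟩ := h
        rw [hc'a]
        refine hy' i ?_
        by_contra! hup
        refine absurd (hlt' u hu) (not_lt.2 (ch.le_of_forall_nb f (pVertex_mem u) fun k hk => ?_))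
        refine hup k ?_
        rintro rfl
        exact hk huF.2
      · simp only [c', dif_neg h]
    refine ⟨c', fun v hv => ?_⟩
    rcases Finset.mem_insert.1 hv with rfl | hv
    · refine ch.inducesAt fun i j k hij hik hjk => ?_
      rw [hc'a, hc'a]
      exact hyz i j k hij hik hjk
    · intro u hu F G hFG hvF hvG huF huG
      rw [hc'c F v hv hvF, hc'c G v hv hvG]
      exact hc v hv u hu F G hFG hvF hvG huF huG

end Cochains

/-! ### Edge-cycles, their sides and their lengths -/

section Curves

variable {P : Set E3} {γ : (edgeGraph P).Subgraph}

lemma IsSimpleEdgeCycle.ncard_neighborSet (hγ : IsSimpleEdgeCycle γ) {v : PVertex P}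
    (hv : v ∈ γ.verts) : (γ.neighborSet v).ncard = 2 := by
  obtain ⟨u, p, hp, rfl⟩ := hγ
  exact hp.ncard_neighborSet_toSubgraph_eq_two (p.mem_verts_toSubgraph.1 hv)

/-- Of the three edges at a vertex of a simple edge-cycle, exactly one is off the cycle. -/
lemma VertexChart.exists_indices {v : PVertex P} (ch : VertexChart v) (hγ : IsSimpleEdgeCycle γ)
    (hv : v ∈ γ.verts) : ∃ i j k, i ≠ j ∧ i ≠ k ∧ j ≠ k ∧ γ.Adj v (ch.nb i) ∧
      γ.Adj v (ch.nb j) ∧ ¬ γ.Adj v (ch.nb k) := by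
  obtain ⟨a, b, hab, hset⟩ := Set.ncard_eq_two.1 (hγ.ncard_neighborSet hv)
  have ha : γ.Adj v a := by
    have : a ∈ γ.neighborSet v := by simp [hset]
    exact this
  have hb : γ.Adj v b := by
    have : b ∈ γ.neighborSet v := by simp [hset]
    exact this
  obtain ⟨i, rfl⟩ := ch.exists_nb_eq ha.adj_sub
  obtain ⟨j, rfl⟩ := ch.exists_nb_eq hb.adj_sub
  have hij : i ≠ j := fun h => hab (h ▸ rfl)
  obtain ⟨k, hik, hjk⟩ : ∃ k, i ≠ k ∧ j ≠ k := by
    clear hset hab ha hb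
    revert i j; decide
  refine ⟨i, j, k, hij, hik, hjk, ha, hb, fun hk => ?_⟩
  have : ch.nb k ∈ γ.neighborSet v := hk
  rw [hset] at this
  rcases this with h | h
  · exact hik (ch.nb_injective h).symm
  · exact hjk (ch.nb_injective h).symm

lemma exists_off_neighbor (hP : IsSimpleThreePolytope P) (hγ : IsSimpleEdgeCycle γ)
    {v : PVertex P} (hv : v ∈ γ.verts) :
    ∃ w, ((edgeGraph P).Adj v w ∧ ¬ γ.Adj v w) ∧
      ∀ u, (edgeGraph P).Adj v u ∧ ¬ γ.Adj v u → u = w := by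
  obtain ⟨ch⟩ := nonempty_vertexChart hP v
  obtain ⟨i, j, k, hij, hik, hjk, hi, hj, hk⟩ := ch.exists_indices hγ hv
  refine ⟨ch.nb k, ⟨ch.adj_nb (convex_of_isSimpleThreePolytope hP) k, hk⟩, ?_⟩
  rintro u ⟨hu, hun⟩
  obtain ⟨l, rfl⟩ := ch.exists_nb_eq hu
  have hli : l ≠ i := fun h => hun (h ▸ hi)
  have hlj : l ≠ j := fun h => hun (h ▸ hj)
  rw [show l = k by omega]

lemma mem_verts_of_mem_curve {v : PVertex P} (h : (v : E3) ∈ curve γ) : v ∈ γ.verts := by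
  obtain ⟨a, b, hab, hv⟩ := h
  rcases mem_segment_pVertex hv with rfl | rfl
  · exact hab.fst_mem
  · exact hab.snd_mem

lemma disjoint_openSegment_curve {v w : PVertex P} (h : (edgeGraph P).Adj v w)
    (hn : ¬ γ.Adj v w) : Disjoint (openSegment ℝ (v : E3) w) (curve γ) := by
  rw [Set.disjoint_left]
  rintro x hx ⟨a, b, hab, hx'⟩
  rcases eq_or_eq_of_mem_openSegment h hab.adj_sub hx hx' with ⟨rfl, rfl⟩ | ⟨rfl, rfl⟩
  · exact hn hab
  · exact hn hab.symm

/-- Edge-cycles without a common vertex are disjoint as curves. -/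
lemma disjoint_curve {γ' : (edgeGraph P).Subgraph} (h : Disjoint γ.verts γ'.verts) :
    Disjoint (curve γ) (curve γ') := by
  rw [Set.disjoint_left]
  rintro x ⟨a, b, hab, hx⟩ ⟨a', b', hab', hx'⟩
  rw [Set.disjoint_left] at h
  have hmem : ∀ u : PVertex P, u ∈ γ.verts → (u : E3) = x → False := by
    rintro u hu rfl
    rcases mem_segment_pVertex hx' with rfl | rfl
    · exact h hu hab'.fst_mem
    · exact h hu hab'.snd_mem
  rw [← insert_endpoints_openSegment] at hx
  rcases hx with rfl | rfl | hx
  · exact hmem a hab.fst_mem rfl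
  · exact hmem b hab.snd_mem rfl
  · rcases eq_or_eq_of_mem_openSegment hab.adj_sub hab'.adj_sub hx hx' with ⟨rfl, rfl⟩ | ⟨rfl, rfl⟩
    · exact h hab.fst_mem hab'.fst_mem
    · exact h hab.fst_mem hab'.snd_mem

lemma openSegment_subset_compl (hP : IsSimpleThreePolytope P) {v w : PVertex P}
    (h : (edgeGraph P).Adj v w) (hn : ¬ γ.Adj v w) :
    openSegment ℝ (v : E3) w ⊆ frontier P \ curve γ := fun _ hx =>
  ⟨segment_subset_frontier hP h (openSegment_subset_segment ℝ _ _ hx),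
    Set.disjoint_left.1 (disjoint_openSegment_curve h hn) hx⟩

lemma IsSide.subset_of_isPreconnected {C T : Set E3} (hC : IsSide γ C) (hT : IsPreconnected T)
    (hsub : T ⊆ frontier P \ curve γ) {y : E3} (hyT : y ∈ T) (hyC : y ∈ C) : T ⊆ C := by
  obtain ⟨x, _, rfl⟩ := hC
  rw [connectedComponentIn_eq hyC]
  exact hT.subset_connectedComponentIn hyT hsub

lemma isPreconnected_insert_openSegment (x y : E3) :
    IsPreconnected (insert x (openSegment ℝ x y)) := by
  refine (convex_openSegment x y).isPreconnected.subset_closure (Set.subset_insert _ _) ?_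
  rw [closure_openSegment]
  exact Set.insert_subset (left_mem_segment ℝ x y) (openSegment_subset_segment ℝ x y)

lemma openSegment_nonempty (x y : E3) : (openSegment ℝ x y).Nonempty :=
  ⟨midpoint ℝ x y, midpoint_mem_openSegment x y⟩

lemma insert_openSegment_subset_compl (hP : IsSimpleThreePolytope P) {v w : PVertex P}
    (h : (edgeGraph P).Adj v w) (hn : ¬ γ.Adj v w) (hv : v ∉ γ.verts) :
    insert (v : E3) (openSegment ℝ (v : E3) w) ⊆ frontier P \ curve γ :=
  Set.insert_subset ⟨segment_subset_frontier hP h (left_mem_segment ℝ _ _),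
    fun hv' => hv (mem_verts_of_mem_curve hv')⟩ (openSegment_subset_compl hP h hn)

lemma IsSide.openSegment_subset (hP : IsSimpleThreePolytope P) {C : Set E3} (hC : IsSide γ C)
    {v w : PVertex P} (h : (edgeGraph P).Adj v w) (hv : v ∉ γ.verts) (hvC : (v : E3) ∈ C) :
    openSegment ℝ (v : E3) w ⊆ C :=
  (Set.subset_insert _ _).trans (hC.subset_of_isPreconnected
    (isPreconnected_insert_openSegment _ _)
    (insert_openSegment_subset_compl hP h (fun hn => hv hn.fst_mem) hv) (Set.mem_insert _ _) hvC)

lemma IsSide.mem_of_openSegment_subset (hP : IsSimpleThreePolytope P) {C : Set E3}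
    (hC : IsSide γ C) {v w : PVertex P} (h : (edgeGraph P).Adj v w) (hw : w ∉ γ.verts)
    (hvw : openSegment ℝ (v : E3) w ⊆ C) : (w : E3) ∈ C := by
  rw [openSegment_symm] at hvw
  obtain ⟨y, hy⟩ := openSegment_nonempty (w : E3) v
  exact hC.subset_of_isPreconnected (isPreconnected_insert_openSegment (w : E3) v)
    (insert_openSegment_subset_compl hP h.symm (fun hn => hw hn.fst_mem) hw)
    (Set.mem_insert_of_mem _ hy) (hvw hy) (Set.mem_insert _ _)

/-- If every side of a simple edge-cycle receives an even number of edges, the cycle has even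
length: the edges leaving the cycle are partitioned by the sides they enter. -/
lemma even_ncard_verts (hP : IsSimpleThreePolytope P) (hγ : IsSimpleEdgeCycle γ)
    (heven : ∀ C, IsSide γ C → Even (inwardVertices γ C).ncard) : Even γ.verts.ncard := by
  classical
  have := finite_pVertex hP
  choose! o ho hou using fun v (hv : v ∈ γ.verts) => exists_off_neighbor hP hγ hv
  let m : PVertex P → E3 := fun v => midpoint ℝ (v : E3) (o v)
  let side : PVertex P → Set E3 := fun v => connectedComponentIn (frontier P \ curve γ) (m v)
  have hopen : ∀ v ∈ γ.verts, openSegment ℝ (v : E3) (o v) ⊆ frontier P \ curve γ := fun v hv =>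
    openSegment_subset_compl hP (ho v hv).1 (ho v hv).2
  have hfin : γ.verts.Finite := Set.toFinite _
  rw [Set.ncard_eq_toFinset_card _ hfin, Finset.card_eq_sum_card_image side]
  refine Finset.even_sum _ fun C hC => ?_
  obtain ⟨v, hv, rfl⟩ := Finset.mem_image.1 hC
  rw [hfin.mem_toFinset] at hv
  have hside : IsSide γ (side v) :=
    ⟨m v, hopen v hv (midpoint_mem_openSegment _ _), rfl⟩
  have hset : inwardVertices γ (side v)
      = ((hfin.toFinset.filter fun u => side u = side v : Finset (PVertex P)) : Set _) := by
    ext u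
    simp only [inwardVertices, Set.mem_ofPred_eq, Finset.coe_filter, hfin.mem_toFinset]
    refine and_congr_right fun hu => ⟨?_, fun h => ?_⟩
    · rintro ⟨w, hw, hwn, hsub⟩
      obtain rfl := hou u hu w ⟨hw, hwn⟩
      exact (connectedComponentIn_eq (hsub (midpoint_mem_openSegment _ _))).symm
    · refine ⟨o u, (ho u hu).1, (ho u hu).2, ?_⟩
      rw [← h]
      exact (convex_openSegment _ _).isPreconnected.subset_connectedComponentIn
        (midpoint_mem_openSegment _ _) (hopen u hu)
  rw [← Set.ncard_coe_finset, ← hset]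
  exact heven _ hside

end Curves

section AlternatingColouring

variable {V : Type*} {G : SimpleGraph V}

lemma SimpleGraph.Walk.IsCycle.ncard_verts_toSubgraph {v : V} {p : G.Walk v v}
    (hp : p.IsCycle) : p.toSubgraph.verts.ncard = p.length := by
  classical
  have : p.toSubgraph.verts = (p.support.tail.toFinset : Set V) := by
    ext w
    rw [SimpleGraph.Walk.mem_verts_toSubgraph, List.coe_toFinset, Set.mem_ofPred_eq]
    refine ⟨fun hw => ?_, List.mem_of_mem_tail⟩
    rw [← p.cons_tail_support] at hw
    rcases List.mem_cons.1 hw with rfl | hw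
    · exact SimpleGraph.Walk.end_mem_tail_support hp.not_nil
    · exact hw
  rw [this, Set.ncard_coe_finset, List.toFinset_card_of_nodup hp.support_nodup]
  simp

/-- The edges of a cycle of even length can be coloured alternately. -/
lemma SimpleGraph.Walk.IsCycle.exists_alternating {v : V} {p : G.Walk v v}
    (hp : p.IsCycle) (heven : Even p.length) :
    ∃ t : V → V → ZMod 2, (∀ a b, t a b = t b a) ∧
      ∀ a b b', b ≠ b' → p.toSubgraph.Adj a b → p.toSubgraph.Adj a b' → t a b + t a b' = 1 := by
  classical
  let t : V → V → ZMod 2 := fun a b => (p.edges.idxOf s(a, b) : ZMod 2)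
  have hsymm : ∀ a b, t a b = t b a := fun a b => by simp only [t, Sym2.eq_swap]
  have hidx : ∀ i, i < p.length → t (p.getVert i) (p.getVert (i + 1)) = (i : ZMod 2) := by
    intro i hi
    have hi' : i < p.edges.length := by rwa [p.length_edges]
    simp only [t]
    rw [← p.getElem_edges hi', hp.edges_nodup.idxOf_getElem]
  have h3 := hp.three_le_length
  have h2 : (2 : ZMod 2) = 0 := rfl
  refine ⟨t, hsymm, fun a b b' hbb' hab hab' => ?_⟩
  suffices h : ∃ c d, p.toSubgraph.neighborSet a = {c, d} ∧ t a c + t a d = 1 by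
    obtain ⟨c, d, hcd, h1⟩ := h
    have hb : b ∈ p.toSubgraph.neighborSet a := hab
    have hb' : b' ∈ p.toSubgraph.neighborSet a := hab'
    rw [hcd] at hb hb'
    rcases hb with rfl | rfl <;> rcases hb' with rfl | rfl
    · exact absurd rfl hbb'
    · exact h1
    · rw [add_comm]; exact h1
    · exact absurd rfl hbb'
  obtain ⟨i, rfl, hi⟩ := SimpleGraph.Walk.mem_support_iff_exists_getVert.1
    (SimpleGraph.Walk.mem_verts_toSubgraph _ |>.1 hab.fst_mem)
  by_cases h0 : i = 0 ∨ i = p.length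
  · have hv : p.getVert i = v := by rcases h0 with rfl | rfl <;> simp
    rw [hv]
    refine ⟨_, _, hp.neighborSet_toSubgraph_endpoint, ?_⟩
    have e1 := hidx 0 (by omega)
    have e2 := hidx (p.length - 1) (by omega)
    rw [Nat.sub_add_cancel (by omega), p.getVert_length] at e2
    rw [p.getVert_zero] at e1
    rw [hsymm v p.penultimate]
    change t v (p.getVert (0 + 1)) + t (p.getVert (p.length - 1)) v = 1
    rw [e1, e2, Nat.cast_sub (by omega), (ZMod.natCast_eq_zero_iff_even).2 heven]
    rfl
  · push Not at h0
    refine ⟨_, _, hp.neighborSet_toSubgraph_internal h0.1 (by omega), ?_⟩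
    have e1 := hidx i (by omega)
    have e2 := hidx (i - 1) (by omega)
    rw [Nat.sub_add_cancel (by omega)] at e2
    rw [hsymm _ (p.getVert (i - 1)), e1, e2, Nat.cast_sub (by omega)]
    linear_combination ((i : ZMod 2) - 1) * h2

end AlternatingColouring

/-! ### From cycles to colourings, and colour classes of edges -/

section Backward

variable {P : Set E3}

/-- Adjacent facets of a simple 3-polytope are two of the three facets at a common vertex. -/
lemma exists_chart_of_facetGraph_adj (hP : IsSimpleThreePolytope P) {F G : PFacet P}
    (h : (facetGraph P).Adj F G) : ∃ (v : PVertex P) (ch : VertexChart v) (i j k : Fin 3),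
      i ≠ j ∧ i ≠ k ∧ j ≠ k ∧ ch.facet i = F ∧ ch.facet j = G := by
  obtain ⟨hne, hFG⟩ := h
  obtain ⟨v, hvF, hvG⟩ := exists_pVertex_mem hP (F.2.2.1.inter G.2.2.1) hFG
  obtain ⟨ch⟩ := nonempty_vertexChart hP v
  obtain ⟨i, rfl⟩ := ch.exists_facet_eq hvF
  obtain ⟨j, rfl⟩ := ch.exists_facet_eq hvG
  have hij : i ≠ j := fun h => hne (h ▸ rfl)
  obtain ⟨k, hik, hjk⟩ : ∃ k, i ≠ k ∧ j ≠ k := by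
    clear hvF hvG hFG hne
    revert i j; decide
  exact ⟨v, ch, i, j, k, hij, hik, hjk, rfl, rfl⟩

/-- A family of disjoint simple edge-cycles of even length through all vertices gives a
four-colouring: the edges are three-coloured, alternately along the cycles and with the third colour
off the cycles, and this edge colouring is induced by a colouring of the facets. -/
lemma colorable_of_even_cycles (hP : IsSimpleThreePolytope P)
    (S : Set ((edgeGraph P).Subgraph)) (hS : ∀ γ ∈ S, IsSimpleEdgeCycle γ)
    (hcover : ∀ v : PVertex P, ∃! γ, γ ∈ S ∧ v ∈ γ.verts)
    (heven : ∀ γ ∈ S, Even γ.verts.ncard) : (facetGraph P).Colorable 4 := by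
  classical
  have halt : ∀ γ ∈ S, ∃ t : PVertex P → PVertex P → ZMod 2, (∀ a b, t a b = t b a) ∧
      ∀ a b b', b ≠ b' → γ.Adj a b → γ.Adj a b' → t a b + t a b' = 1 := by
    intro γ hγ
    have he := heven γ hγ
    obtain ⟨v, p, hp, rfl⟩ := hS γ hγ
    rw [hp.ncard_verts_toSubgraph] at he
    exact hp.exists_alternating he
  choose! t htsymm ht using halt
  choose g hg hguniq using hcover
  have hgadj : ∀ v w, (g v).Adj v w → g w = g v := fun v w h =>
    (hguniq w (g v) ⟨(hg v).1, h.snd_mem⟩).symm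
  let x : PVertex P → PVertex P → ZMod 2 × ZMod 2 := fun v w =>
    if (g v).Adj v w then (1, t (g v) v w) else (0, 1)
  have hx1 : ∀ v w, (g v).Adj v w → x v w = (1, t (g v) v w) := fun v w h => if_pos h
  have hx0 : ∀ v w, ¬ (g v).Adj v w → x v w = (0, 1) := fun v w h => if_neg h
  have hxne : ∀ v w, x v w ≠ 0 := by
    intro v w
    by_cases h : (g v).Adj v w
    · rw [hx1 v w h]; exact fun h => one_ne_zero (congrArg Prod.fst h)
    · rw [hx0 v w h]; exact fun h => one_ne_zero (congrArg Prod.snd h)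
  have hxsymm : ∀ v w, x v w = x w v := by
    intro v w
    by_cases h : (g v).Adj v w
    · have h' : (g w).Adj w v := by rw [hgadj v w h]; exact h.symm
      rw [hx1 v w h, hx1 w v h', hgadj v w h, htsymm _ (hg v).1]
    · have h' : ¬ (g w).Adj w v := fun h' => h (by rw [hgadj w v h']; exact h'.symm)
      rw [hx0 v w h, hx0 w v h']
  have h2 : (2 : ZMod 2 × ZMod 2) = 0 := rfl
  have hsum : ∀ (v : PVertex P) (ch : VertexChart v), ∑ k, x v (ch.nb k) = 0 := by
    intro v ch
    obtain ⟨i, j, k, hij, hik, hjk, hi, hj, hk⟩ := ch.exists_indices (hS _ (hg v).1) (hg v).2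
    have huniv : (Finset.univ : Finset (Fin 3)) = {i, j, k} := by
      clear hi hj hk
      revert i j k; decide
    have h1 := ht _ (hg v).1 v _ _ (ch.nb_injective.ne hij) hi hj
    rw [huniv, Finset.sum_insert (by simp [hij, hik]), Finset.sum_pair hjk, hx1 _ _ hi, hx1 _ _ hj,
      hx0 _ _ hk, ← add_assoc, Prod.mk_add_mk, Prod.mk_add_mk, h1]
    rfl
  obtain ⟨c, hc⟩ := exists_inducesAt hP h2 x hxsymm hsum
  let col : (facetGraph P).Coloring (ZMod 2 × ZMod 2) := SimpleGraph.Coloring.mk c (by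
    intro F G hFG heq
    obtain ⟨v, ch, i, j, k, hij, hik, hjk, rfl, rfl⟩ := exists_chart_of_facetGraph_adj hP hFG
    have h := hc v _ (ch.adj_nb (convex_of_isSimpleThreePolytope hP) k) _ _
      (ch.facet_injective.ne hij) (ch.mem_facet i) (ch.mem_facet j) (ch.nb_mem_facet.2 hik)
      (ch.nb_mem_facet.2 hjk)
    rw [heq, ← two_mul, h2, zero_mul] at h
    exact hxne _ _ h.symm)
  have : Fintype.card (ZMod 2 × ZMod 2) = 4 := by simp
  rw [← this]
  exact col.colorable

end Backward

section Forward

variable {P : Set E3}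

/-- The graph of the edges of `P` whose two facets have colours with sum `τ`. -/
def colorClass (c : PFacet P → ZMod 2 × ZMod 2) (τ : ZMod 2 × ZMod 2) :
    SimpleGraph (PVertex P) where
  Adj v w := (edgeGraph P).Adj v w ∧ ∃ F G : PFacet P, F ≠ G ∧ (v : E3) ∈ (F : Set E3) ∧
    (v : E3) ∈ (G : Set E3) ∧ (w : E3) ∈ (F : Set E3) ∧ (w : E3) ∈ (G : Set E3) ∧ c F + c G = τ
  symm := ⟨fun _ _ ⟨h, F, G, h1, h2, h3, h4, h5, h6⟩ => ⟨h.symm, F, G, h1, h4, h5, h2, h3, h6⟩⟩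
  loopless := ⟨fun _ h => h.1.1 rfl⟩

lemma colorClass_adj_nb (hP : IsSimpleThreePolytope P) {v : PVertex P} (ch : VertexChart v)
    {c : PFacet P → ZMod 2 × ZMod 2} {τ : ZMod 2 × ZMod 2} {i j k : Fin 3} (hij : i ≠ j)
    (hik : i ≠ k) (hjk : j ≠ k) :
    (colorClass c τ).Adj v (ch.nb k) ↔ c (ch.facet i) + c (ch.facet j) = τ := by
  constructor
  · rintro ⟨_, F, G, hFG, hvF, hvG, hwF, hwG, h⟩
    obtain ⟨i', rfl⟩ := ch.exists_facet_eq hvF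
    obtain ⟨j', rfl⟩ := ch.exists_facet_eq hvG
    have hi' := ch.nb_mem_facet.1 hwF
    have hj' := ch.nb_mem_facet.1 hwG
    have hij' : i' ≠ j' := fun h => hFG (h ▸ rfl)
    obtain ⟨rfl, rfl⟩ | ⟨rfl, rfl⟩ : (i' = i ∧ j' = j) ∨ (i' = j ∧ j' = i) := by omega
    · exact h
    · rw [add_comm]; exact h
  · intro h
    exact ⟨ch.adj_nb (convex_of_isSimpleThreePolytope hP) k, _, _, ch.facet_injective.ne hij,
      ch.mem_facet i, ch.mem_facet j, ch.nb_mem_facet.2 hik, ch.nb_mem_facet.2 hjk, h⟩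

lemma colorClass_le (c : PFacet P → ZMod 2 × ZMod 2) (τ : ZMod 2 × ZMod 2) :
    colorClass c τ ≤ edgeGraph P := fun _ _ h => h.1

lemma colorClass_unique (hP : IsSimpleThreePolytope P) {c : PFacet P → ZMod 2 × ZMod 2}
    {τ τ' : ZMod 2 × ZMod 2} {v w : PVertex P} (h : (colorClass c τ).Adj v w)
    (h' : (colorClass c τ').Adj v w) : τ = τ' := by
  obtain ⟨ch⟩ := nonempty_vertexChart hP v
  obtain ⟨k, rfl⟩ := ch.exists_nb_eq h.1
  obtain ⟨i, j, hij, hik, hjk⟩ : ∃ i j, i ≠ j ∧ i ≠ k ∧ j ≠ k := by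
    clear h h'
    revert k; decide
  rw [colorClass_adj_nb hP ch hij hik hjk] at h h'
  rw [← h, h']

/-- The edges at a vertex have the three nonzero colours: each nonzero colour class is a perfect
matching. -/
lemma existsUnique_colorClass_adj (hP : IsSimpleThreePolytope P) {c : PFacet P → ZMod 2 × ZMod 2}
    (hc : ∀ F G, (facetGraph P).Adj F G → c F ≠ c G) {τ : ZMod 2 × ZMod 2} (hτ : τ ≠ 0)
    (v : PVertex P) : ∃! w, (colorClass c τ).Adj v w := by
  obtain ⟨ch⟩ := nonempty_vertexChart hP v
  have hinj : ∀ i j, i ≠ j → c (ch.facet i) ≠ c (ch.facet j) := fun i j hij =>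
    hc _ _ ⟨ch.facet_injective.ne hij, v, ch.mem_facet i, ch.mem_facet j⟩
  have hdec : ∀ a b d τ : ZMod 2 × ZMod 2, a ≠ b ∧ a ≠ d ∧ b ≠ d ∧ τ ≠ 0 →
      (a + b = τ ∨ a + d = τ ∨ b + d = τ) := by decide
  have hex : ∃ w, (colorClass c τ).Adj v w := by
    rcases hdec _ _ _ τ ⟨hinj 0 1 (by decide), hinj 0 2 (by decide), hinj 1 2 (by decide), hτ⟩
      with h | h | h
    · exact ⟨ch.nb 2, (colorClass_adj_nb hP ch (by decide) (by decide) (by decide)).2 h⟩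
    · exact ⟨ch.nb 1, (colorClass_adj_nb hP ch (by decide) (by decide) (by decide)).2 h⟩
    · exact ⟨ch.nb 0, (colorClass_adj_nb hP ch (by decide) (by decide) (by decide)).2 h⟩
  obtain ⟨w, hw⟩ := hex
  refine ⟨w, hw, fun u hu => ?_⟩
  dsimp only at hu
  obtain ⟨k, rfl⟩ := ch.exists_nb_eq hw.1
  obtain ⟨l, rfl⟩ := ch.exists_nb_eq hu.1
  by_contra hne
  have hkl : k ≠ l := fun h => hne (h ▸ rfl)
  obtain ⟨i, hik, hil⟩ : ∃ i, i ≠ k ∧ i ≠ l := by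
    clear hw hu hne
    revert k l; decide
  rw [colorClass_adj_nb hP ch hil hik hkl.symm] at hw
  rw [colorClass_adj_nb hP ch hik hil hkl] at hu
  exact hinj k l hkl (add_left_cancel (hu.trans hw.symm))

lemma exists_colorClass_adj (hP : IsSimpleThreePolytope P) {c : PFacet P → ZMod 2 × ZMod 2}
    (hc : ∀ F G, (facetGraph P).Adj F G → c F ≠ c G) {v w : PVertex P}
    (h : (edgeGraph P).Adj v w) : ∃ τ, τ ≠ 0 ∧ (colorClass c τ).Adj v w := by
  obtain ⟨ch⟩ := nonempty_vertexChart hP v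
  obtain ⟨k, rfl⟩ := ch.exists_nb_eq h
  obtain ⟨i, j, hij, hik, hjk⟩ : ∃ i j, i ≠ j ∧ i ≠ k ∧ j ≠ k := by
    clear h
    revert k; decide
  refine ⟨_, fun h0 => ?_, (colorClass_adj_nb hP ch hij hik hjk).2 rfl⟩
  have hne : c (ch.facet i) ≠ c (ch.facet j) :=
    hc _ _ ⟨ch.facet_injective.ne hij, v, ch.mem_facet i, ch.mem_facet j⟩
  exact hne ((by decide : ∀ a b : ZMod 2 × ZMod 2, a + b = 0 → a = b) _ _ h0)

/-- A finite set closed under a perfect matching has even cardinality. -/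
lemma even_ncard_of_perfect_matching {V : Type*} [Finite V] {M : SimpleGraph V}
    (hM : ∀ v, ∃! w, M.Adj v w) {X : Set V} (hX : ∀ v ∈ X, ∀ w, M.Adj v w → w ∈ X) :
    Even X.ncard := by
  classical
  choose m hm hmu using hM
  have hfin : X.Finite := Set.toFinite X
  rw [Set.ncard_eq_toFinset_card X hfin, ← ZMod.natCast_eq_zero_iff_even]
  have h := Finset.sum_involution (s := hfin.toFinset) (f := fun _ => (1 : ZMod 2))
    (fun v _ => m v) (fun _ _ => rfl) (fun v _ _ h => (hm v).ne h.symm)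
    (fun v hv => hfin.mem_toFinset.2 (hX v (hfin.mem_toFinset.1 hv) _ (hm v)))
    (fun v _ => (hmu (m v) v (hm v).symm).symm)
  simpa using h

/-- The part of a spanning subgraph `H` of `G` over one of its connected components. -/
def componentSubgraph {V : Type*} {G H : SimpleGraph V} (h : H ≤ G) (K : H.ConnectedComponent) :
    G.Subgraph where
  verts := K.supp
  Adj v w := H.Adj v w ∧ v ∈ K.supp
  adj_sub hvw := h hvw.1
  edge_vert hvw := hvw.2
  symm := ⟨fun _ _ hvw => ⟨hvw.1.symm, K.mem_supp_of_adj_mem_supp hvw.2 hvw.1⟩⟩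

lemma componentSubgraph_eq_toSubgraph {V : Type*} [Finite V] {G H : SimpleGraph V} (h : H ≤ G)
    (hH : ∀ v, (H.neighborSet v).ncard = 2) (K : H.ConnectedComponent) :
    ∃ (v : V) (p : G.Walk v v), p.IsCycle ∧ p.toSubgraph = componentSubgraph h K := by
  classical
  have := Fintype.ofFinite V
  have hcyc : H.IsCycles := fun v _ => hH v
  obtain ⟨v, hv⟩ := K.nonempty_supp
  obtain ⟨p, hp, hverts⟩ := hcyc.exists_cycle_toSubgraph_verts_eq_connectedComponentSupp hv
    (Set.nonempty_of_ncard_ne_zero (by rw [hH v]; norm_num))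
  refine ⟨v, p.mapLe h, hp.mapLe h, SimpleGraph.Subgraph.ext ?_ ?_⟩
  · change _ = K.supp
    rw [← hverts]
    ext w
    simp only [SimpleGraph.Walk.mem_verts_toSubgraph, SimpleGraph.Walk.support_mapLe_eq_support]
  · ext a b
    rw [SimpleGraph.Walk.adj_toSubgraph_mapLe]
    constructor
    · intro hab
      exact ⟨hab.adj_sub, hverts ▸ hab.fst_mem⟩
    · rintro ⟨hab, ha⟩
      exact (hp.adj_toSubgraph_iff_of_isCycles hcyc (hverts ▸ ha) b).2 hab

end Forward

/-! ### From colourings to cycles -/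

section Forward

variable {P : Set E3}

/-- A colouring of the facets by `(ℤ/2)²` yields the required family: the components of the graph of
edges of colours `(1, 0)` and `(0, 1)`. -/
lemma exists_even_cycles (hP : IsSimpleThreePolytope P) {c : PFacet P → ZMod 2 × ZMod 2}
    (hc : ∀ F G, (facetGraph P).Adj F G → c F ≠ c G) :
    ∃ S : Set ((edgeGraph P).Subgraph),
      (∀ γ ∈ S, IsSimpleEdgeCycle γ) ∧ S.PairwiseDisjoint curve ∧
      (∀ v : PVertex P, ∃! γ, γ ∈ S ∧ v ∈ γ.verts) ∧
      (∀ γ ∈ S, ∀ C : Set E3, IsSide γ C → Even (inwardVertices γ C).ncard) := by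
  have := finite_pVertex hP
  have hα := existsUnique_colorClass_adj hP hc (τ := (1, 0)) (by decide)
  have hβ := existsUnique_colorClass_adj hP hc (τ := (0, 1)) (by decide)
  have hμ := existsUnique_colorClass_adj hP hc (τ := (1, 1)) (by decide)
  set H : SimpleGraph (PVertex P) := colorClass c (1, 0) ⊔ colorClass c (0, 1) with hH
  have hle : H ≤ edgeGraph P := sup_le (colorClass_le c _) (colorClass_le c _)
  have hmatch : ∀ {v w : PVertex P}, (edgeGraph P).Adj v w →
      (¬ H.Adj v w ↔ (colorClass c (1, 1)).Adj v w) := by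
    intro v w hvw
    constructor
    · intro hn
      obtain ⟨τ, hτ, hadj⟩ := exists_colorClass_adj hP hc hvw
      rcases (by decide : ∀ τ : ZMod 2 × ZMod 2, τ ≠ 0 → τ = (1, 0) ∨ τ = (0, 1) ∨ τ = (1, 1)) τ hτ
        with rfl | rfl | rfl
      · exact absurd (Or.inl hadj) hn
      · exact absurd (Or.inr hadj) hn
      · exact hadj
    · rintro h (h' | h')
      · exact absurd (colorClass_unique hP h h') (by decide)
      · exact absurd (colorClass_unique hP h h') (by decide)
  have hdeg : ∀ v, (H.neighborSet v).ncard = 2 := by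
    intro v
    obtain ⟨a, ha, hau⟩ := hα v
    obtain ⟨b, hb, hbu⟩ := hβ v
    rw [Set.ncard_eq_two]
    refine ⟨a, b, ?_, ?_⟩
    · rintro rfl
      exact absurd (colorClass_unique hP ha hb) (by decide)
    · ext w
      constructor
      · rintro (h | h)
        · exact Or.inl (hau w h)
        · exact Or.inr (hbu w h)
      · rintro (rfl | rfl)
        · exact Or.inl ha
        · exact Or.inr hb
  have hverts : ∀ {K K' : H.ConnectedComponent} {v : PVertex P}, v ∈ K.supp → v ∈ K'.supp →
      K = K' := fun h h' => h.symm.trans h'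
  refine ⟨Set.range (componentSubgraph hle), ?_, ?_, ?_, ?_⟩
  · rintro _ ⟨K, rfl⟩
    exact componentSubgraph_eq_toSubgraph hle hdeg K
  · rintro _ ⟨K, rfl⟩ _ ⟨K', rfl⟩ hne
    exact disjoint_curve (Set.disjoint_left.2 fun v h h' => hne (hverts h h' ▸ rfl))
  · intro v
    refine ⟨componentSubgraph hle (H.connectedComponentMk v), ⟨⟨_, rfl⟩, rfl⟩, ?_⟩
    rintro _ ⟨⟨K, rfl⟩, hv⟩
    have hv' : v ∈ K.supp := hv
    rw [hverts hv' (show v ∈ (H.connectedComponentMk v).supp from rfl)]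
  · rintro _ ⟨K, rfl⟩ C hC
    set γ := componentSubgraph hle K with hγ
    have hoff : ∀ {v w : PVertex P}, v ∈ γ.verts → (edgeGraph P).Adj v w →
        (¬ γ.Adj v w ↔ (colorClass c (1, 1)).Adj v w) := fun hv hvw =>
      (not_congr (and_iff_left hv)).trans (hmatch hvw)
    -- The vertices off the cycle on this side are matched by the edges of colour `(1, 0)`.
    let X : Set (PVertex P) := {v | v ∉ γ.verts ∧ (v : E3) ∈ C}
    have hXeven : Even X.ncard := by
      refine even_ncard_of_perfect_matching hα ?_
      rintro v ⟨hv, hvC⟩ w hvw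
      have hw : w ∉ γ.verts := fun hw =>
        hv (K.mem_supp_of_adj_mem_supp hw (show H.Adj w v from Or.inl hvw.symm))
      exact ⟨hw, hC.mem_of_openSegment_subset hP hvw.1 hw (hC.openSegment_subset hP hvw.1 hv hvC)⟩
    -- Together with the inward vertices they are matched by the edges of colour `(1, 1)`.
    have hXI : Even (X ∪ inwardVertices γ C).ncard := by
      refine even_ncard_of_perfect_matching hμ ?_
      intro v hv w hvw
      have hopen : openSegment ℝ (v : E3) w ⊆ C := by
        rcases hv with ⟨hv, hvC⟩ | ⟨hv, u, hu, hun, hsub⟩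
        · exact hC.openSegment_subset hP hvw.1 hv hvC
        · rwa [(hμ v).unique hvw ((hoff hv hu).1 hun)]
      by_cases hw : w ∈ γ.verts
      · refine Or.inr ⟨hw, v, hvw.1.symm, (hoff hw hvw.1.symm).2 hvw.symm, ?_⟩
        rwa [openSegment_symm]
      · exact Or.inl ⟨hw, hC.mem_of_openSegment_subset hP hvw.1 hw hopen⟩
    rw [Set.ncard_union_eq (Set.disjoint_left.2 fun v hv hv' => hv.1 hv'.1)] at hXI
    exact (Nat.even_add.1 hXI).1 hXeven

end Forward

theorem corollary4p20 (P : Set E3) (hP : IsSimpleThreePolytope P) :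
    (facetGraph P).Colorable 4 ↔
      ∃ S : Set ((edgeGraph P).Subgraph),
        (∀ γ ∈ S, IsSimpleEdgeCycle γ) ∧
        S.PairwiseDisjoint curve ∧
        (∀ v : PVertex P, ∃! γ, γ ∈ S ∧ v ∈ γ.verts) ∧
        (∀ γ ∈ S, ∀ C : Set E3, IsSide γ C → Even (inwardVertices γ C).ncard) := by
  constructor
  · intro h
    let col := h.toColoring (α := ZMod 2 × ZMod 2) (by simp)
    exact exists_even_cycles hP (c := col) fun F G hFG => col.valid hFG
  · rintro ⟨S, hS, _, hcover, heven⟩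
    exact colorable_of_even_cycles hP S hS hcover fun γ hγ =>
      even_ncard_verts hP (hS γ hγ) (heven γ hγ)
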